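/- Let $K$ be a field, $m,n\ge 0$, and let $S=K[x_1,\dots,x_m,y_1,\dots,y_n]$ be the standard bigraded polynomial ring, $\deg x_i=(1,0)$ and $\deg y_j=(0,1)$. Put $Q=(y_1,\dots,y_n)$. For a finitely generated $S$-module $N$ let $H^k_Q(N)$ denote the local cohomology modules of $N$ with support in $Q$, let $\operatorname{cd}(Q,N)$ be the largest integer $k$ with $H^k_Q(N)\neq 0$ (with $\operatorname{cd}(Q,0)=-\infty$), and let $\operatorname{grade}(Q,N)$ be the supremum of the lengths of the $N$-regular sequences contained in $Q$ (with the usual convention $\operatorname{grade}(Q,N)=\infty$ if $QN=N$). The module $N$ is called Cohen–Macaulay with respect to $Q$ if there is an integer $q$ such that $H^k_Q(N)=0$ for all $k\neq q$. Let $M$ be a finitely generated ($\mathbb Z^2$-)bigraded $S$-module. A Cohen–Macaulay filtration of $M$ with respect to $Q$ is a finite filtration $0=F_0\subsetneq F_1\subsetneq\cdots\subsetneq F_s=M$ by bigraded submodules such that each quotient $F_i/F_{i-1}$ is Cohen–Macaulay with respect to $Q$ and $$0\le \operatorname{cd}(Q,F_1/F_0)<\operatorname{cd}(Q,F_2/F_1)<\cdots<\operatorname{cd}(Q,F_s/F_{s-1}).$$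 $M$ is called sequentially Cohen–Macaulay with respect to $Q$ if it admits a Cohen–Macaulay filtration with respect to $Q$. A filtration $0=M_0\subsetneq M_1\subsetneq\cdots\subsetneq M_r=M$ by bigraded submodules is called the dimension filtration of $M$ with respect to $Q$ if, for every $i=1,\dots,r$, $M_{i-1}$ is the largest bigraded submodule $N$ of $M_i$ with $\operatorname{cd}(Q,N)<\operatorname{cd}(Q,M_i)$. Let $0=M_0\subsetneq M_1\subsetneq\cdots\subsetneq M_r=M$ be the dimension filtration of $M$ with respect to $Q$. Then the following statements are equivalent: (a) $M$ is sequentially Cohen–Macaulay with respect to $Q$; (b) $H^k_Q(M/M_{i-1})=0$ for $i=1,\dots,r$ and all $k<\operatorname{cd}(Q,M_i)$; (c) $\operatorname{grade}(Q,M/M_{i-1})=\operatorname{cd}(Q,M_i)$ for $i=1,\dots,r$. -/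

import Mathlib

open CategoryTheory

universe u

noncomputable section

namespace BigradedCM

/-- The standard bigraded polynomial ring `S = K[x₁, …, x_m, y₁, …, y_n]`: the variables indexed by
`Sum.inl` are the `x`'s, those indexed by `Sum.inr` are the `y`'s. -/
abbrev S (K : Type u) [Field K] (m n : ℕ) : Type u := MvPolynomial (Fin m ⊕ Fin n) K

/-- The bidegrees of the variables: `deg xᵢ = (1, 0)` and `deg yⱼ = (0, 1)`. -/
def varDeg (m n : ℕ) : Fin m ⊕ Fin n → ℤ × ℤ :=
  Sum.elim (fun _ => (1, 0)) (fun _ => (0, 1))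

/-- The standard bigrading of `S`: the component of bidegree `d` is spanned over `K` by the
monomials of bidegree `d`. -/
abbrev bigrading (K : Type u) [Field K] (m n : ℕ) : ℤ × ℤ → Submodule K (S K m n) :=
  MvPolynomial.weightedHomogeneousSubmodule K (varDeg m n)

/-- The bigraded irrelevant ideal `Q = (y₁, …, y_n)` of `S`. -/
def Q (K : Type u) [Field K] (m n : ℕ) : Ideal (S K m n) :=
  Ideal.span (Set.range fun j : Fin n => MvPolynomial.X (Sum.inr j))

section Invariants

variable {R : Type u} [CommRing R]

/-- The local cohomology module `Hⁱ_I(N)`. -/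
abbrev H (I : Ideal R) (i : ℕ) (N : Type u) [AddCommGroup N] [Module R N] : ModuleCat.{u} R :=
  (localCohomology I i).obj (ModuleCat.of R N)

/-- The cohomological dimension `cd(I, N)`, the largest `i` with `Hⁱ_I(N) ≠ 0`. It is `-∞` (that
is, `⊥`) if there is no such `i`, in particular for `N = 0`. -/
def cd (I : Ideal R) (N : Type u) [AddCommGroup N] [Module R N] : WithBot ℕ∞ :=
  sSup {c | ∃ i : ℕ, ¬ Limits.IsZero (H I i N) ∧ c = ((i : ℕ∞) : WithBot ℕ∞)}

/-- The grade `grade(I, N)`, the supremum of the lengths of the `N`-regular sequences contained in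
`I`. If `I N ≠ N`, a weakly `N`-regular sequence in `I` is the same as an `N`-regular one; if `N` is
finitely generated and `I N = N`, this gives the usual value `∞`. -/
def grade (I : Ideal R) (N : Type u) [AddCommGroup N] [Module R N] : ℕ∞ :=
  sSup {c | ∃ rs : List R, (∀ r ∈ rs, r ∈ I) ∧ RingTheory.Sequence.IsWeaklyRegular N rs ∧
    c = (rs.length : ℕ∞)}

/-- `N` is Cohen–Macaulay with respect to `I`: for some `q`, `Hⁱ_I(N) = 0` for all `i ≠ q`. -/
def IsCohenMacaulay (I : Ideal R) (N : Type u) [AddCommGroup N] [Module R N] : Prop :=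
  ∃ q : ℕ, ∀ i : ℕ, i ≠ q → Limits.IsZero (H I i N)

end Invariants

section Filtrations

variable {K : Type u} [Field K] {m n : ℕ} {M : Type u} [AddCommGroup M] [Module (S K m n) M]

/-- The successive quotient `F_i / F_{i-1}` of a filtration; the index `i : Fin r`, which starts
at `0`, stands for `i + 1`. -/
abbrev succQuot {r : ℕ} (F : Fin (r + 1) → Submodule (S K m n) M) (i : Fin r) : Type u :=
  ↥(F i.succ) ⧸ (F i.castSucc).submoduleOf (F i.succ)

/-- `0 = F_0 ⊊ F_1 ⊊ ⋯ ⊊ F_r = M` is a finite filtration of the bigraded module `M` by bigraded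
submodules. -/
structure IsBigradedFiltration (ℳ : ℤ × ℤ → AddSubgroup M) [DirectSum.Decomposition ℳ]
    {r : ℕ} (F : Fin (r + 1) → Submodule (S K m n) M) : Prop where
  bot : F 0 = ⊥
  top : F (Fin.last r) = ⊤
  lt : ∀ i : Fin r, F i.castSucc < F i.succ
  homogeneous : ∀ i, (F i).IsHomogeneous ℳ

/-- The filtration `D` is the dimension filtration of `M` with respect to `Q`: for each `i ≥ 1`,
`D_{i-1}` is the largest bigraded submodule `N` of `D_i` with `cd(Q, N) < cd(Q, D_i)`. -/
structure IsDimensionFiltration (ℳ : ℤ × ℤ → AddSubgroup M) [DirectSum.Decomposition ℳ]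
    {r : ℕ} (D : Fin (r + 1) → Submodule (S K m n) M) : Prop
    extends IsBigradedFiltration ℳ D where
  isGreatest : ∀ i : Fin r,
    IsGreatest {N : Submodule (S K m n) M | N.IsHomogeneous ℳ ∧ N ≤ D i.succ ∧
      cd (Q K m n) N < cd (Q K m n) (D i.succ)} (D i.castSucc)

/-- The filtration `F` is a Cohen–Macaulay filtration of `M` with respect to `Q`. -/
structure IsCohenMacaulayFiltration (ℳ : ℤ × ℤ → AddSubgroup M) [DirectSum.Decomposition ℳ]
    {r : ℕ} (F : Fin (r + 1) → Submodule (S K m n) M) : Prop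
    extends IsBigradedFiltration ℳ F where
  cohenMacaulay : ∀ i : Fin r, IsCohenMacaulay (Q K m n) (succQuot F i)
  cd_nonneg : ∀ i : Fin r, 0 ≤ cd (Q K m n) (succQuot F i)
  cd_strictMono : StrictMono fun i : Fin r => cd (Q K m n) (succQuot F i)

variable (K m n) in
/-- The bigraded module `M` is sequentially Cohen–Macaulay with respect to `Q`: it admits a
Cohen–Macaulay filtration with respect to `Q`. -/
def IsSequentiallyCohenMacaulay (ℳ : ℤ × ℤ → AddSubgroup M) [DirectSum.Decomposition ℳ] : Prop :=
  ∃ (r : ℕ) (F : Fin (r + 1) → Submodule (S K m n) M), IsCohenMacaulayFiltration ℳ F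

end Filtrations

end BigradedCM

end

/-! The implication (a) ⇒ (b) carries the weight. In a Cohen–Macaulay filtration `F` with degrees
q_1 < ... < q_s, long exact sequences put the local cohomology of F_{i-1} in degrees < q_i and that
of L = M/F_{i-1} in degrees ≥ q_i. To see that `F` is the dimension filtration, one needs N ≤
F_{i-1} whenever cd(Q, N) < q_i (`le_of_localExtVanish`). A map N → L between modules separated by
degree in this way induces zero on Ext(T, -) for every T killed by a power of Q
(`ext_comp_mk₀_eq_zero`). For T = S/(y_1^t, ..., y_n^t) the top Ext is L/(y_1^t, ..., y_n^t)L, so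
the image of N lies in every Q^t L (`apply_mem_pow_smul_top`). Krull's intersection theorem gives x
- rx ∈ F_{i-1} with r ∈ Q, and the grading by y-degree then forces x ∈ F_{i-1}. Dimension
filtrations are unique, so (b) follows.

For (b) ⇒ (a) the dimension filtration `D` itself works: the sequence of D_i/D_{i-1}, M/D_{i-1},
M/D_i kills the local cohomology of D_i/D_{i-1} below cd(Q, D_i), and that of D_{i-1}, D_i,
D_i/D_{i-1} kills it above. Finally (b) ⇔ (c), since the grade is the first degree with nonzero
local cohomology.

Throughout, vanishing of local cohomology is used in the elementwise form `LocalExtVanish`, to which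
the long exact sequences of Ext apply directly. -/

noncomputable section

/-! ### Ext computed by Hom out of a projective resolution -/

section

open Limits Opposite HomologicalComplex

variable {R : Type u} [CommRing R]

namespace DerivedExt

variable {X : ModuleCat.{u} R} (P : ProjectiveResolution X) (Y : ModuleCat.{u} R) (n : ℕ)

/-- `Hom(P, Y)`, viewed as a chain complex in the opposite category. -/
abbrev homComplex : ChainComplex (ModuleCat.{u} R)ᵒᵖ ℕ :=
  (((linearYoneda R (ModuleCat.{u} R)).obj Y).rightOp.mapHomologicalComplex _).obj P.complex

/-- `Ext` is computed by the homology of `Hom(P, Y)`. -/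
def homologyIso : ((homComplex P Y).homology n).unop ≅
    ((Ext R (ModuleCat.{u} R) n).obj (op X)).obj Y :=
  (P.isoLeftDerivedObj ((linearYoneda R (ModuleCat.{u} R)).obj Y).rightOp n).unop

/-- The class in `Ext` of a cocycle. -/
def ofCocycles : ((homComplex P Y).opcycles n).unop ⟶
    ((Ext R (ModuleCat.{u} R) n).obj (op X)).obj Y :=
  ((homComplex P Y).homologyι n).unop ≫
    (homologyIso P Y n).hom

/-- The inclusion of the cocycles in the cochains. -/
def toCochains : ((homComplex P Y).opcycles n).unop ⟶ ModuleCat.of R (P.complex.X n ⟶ Y) :=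
  ((homComplex P Y).pOpcycles n).unop

lemma ofCocycles_surjective : Function.Surjective (ofCocycles P Y n) := by
  rw [← ModuleCat.epi_iff_surjective]
  have h1 : Epi ((homComplex P Y).homologyι n).unop := inferInstance
  exact @epi_comp _ _ _ _ _ _ h1 _ inferInstance

lemma toCochains_injective : Function.Injective (toCochains P Y n) := by
  rw [← ModuleCat.mono_iff_injective]
  exact (inferInstance : Mono ((homComplex P Y).pOpcycles n).unop)

lemma d_comp_toCochains (z) : P.complex.d (n+1) n ≫ toCochains P Y n z = 0 := by
  have := congrArg (fun f => f.unop z) ((homComplex P Y).d_pOpcycles (n+1) n)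
  exact this

lemma exists_toCochains (f : P.complex.X n ⟶ Y) (hf : P.complex.d (n+1) n ≫ f = 0) :
    ∃ z, toCochains P Y n z = f := by
  have h := ((homComplex P Y).opcyclesIsCokernel (n+1) n (by simp))
  let S : ShortComplex (ModuleCat R)ᵒᵖ := ShortComplex.mk ((homComplex P Y).d (n+1) n)
    ((homComplex P Y).pOpcycles n)
    ((homComplex P Y).d_pOpcycles (n+1) n)
  have hS : S.Exact := S.exact_of_g_is_cokernel h
  have := hS.unop
  rw [ShortComplex.moduleCat_exact_iff] at this
  exact this f hf

lemma ofCocycles_eq_zero_iff (p : ℕ) (hp : p + 1 = n) (z) : ofCocycles P Y n z = 0 ↔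
    ∃ g : P.complex.X p ⟶ Y, P.complex.d n p ≫ g = toCochains P Y n z := by
  let S : ShortComplex (ModuleCat R)ᵒᵖ := ShortComplex.mk ((homComplex P Y).homologyι n)
    ((homComplex P Y).fromOpcycles n p) (by simp)
  have hS : S.Exact := S.exact_of_f_is_kernel
    ((homComplex P Y).homologyIsKernel n p (by subst hp; simp))
  have h := hS.unop
  rw [ShortComplex.moduleCat_exact_iff] at h
  have hd (g) : toCochains P Y n (((homComplex P Y).fromOpcycles n p).unop g) =
      P.complex.d n p ≫ g :=
    congrArg (fun f => f.unop g) ((homComplex P Y).p_fromOpcycles n p)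
  have hi : Function.Injective
      (homologyIso P Y n).hom := by
    rw [← ModuleCat.mono_iff_injective]
    infer_instance
  constructor
  · intro hz
    obtain ⟨g, hg⟩ := h z (hi (hz.trans (map_zero _).symm))
    exact ⟨g, (hd g).symm.trans (congrArg _ hg)⟩
  · rintro ⟨g, hg⟩
    obtain rfl : z = ((homComplex P Y).fromOpcycles n p).unop g :=
      toCochains_injective P Y n (hg.symm.trans (hd g).symm)
    have := congrArg (fun f => f.unop g) ((homComplex P Y).homologyι_comp_fromOpcycles n p)
    have h0 : (homologyι (homComplex P Y) n).unop (((homComplex P Y).fromOpcycles n p).unop g) = 0 :=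
      this
    change (homologyIso P Y n).hom
      ((homologyι (homComplex P Y) n).unop (((homComplex P Y).fromOpcycles n p).unop g)) = 0
    rw [h0, map_zero]

lemma ofCocycles_zero_eq_zero_iff (z) : ofCocycles P Y 0 z = 0 ↔ z = 0 := by
  have h1 : Mono ((homComplex P Y).homologyι 0).unop := by
    have := ChainComplex.isIso_homologyι₀ (homComplex P Y)
    infer_instance
  have h2 : Mono (ofCocycles P Y 0) := @mono_comp _ _ _ _ _ _ h1 _ inferInstance
  rw [ModuleCat.mono_iff_injective] at h2
  exact map_eq_zero_iff _ h2

/-- The transition maps of both models of Ext are precomposition with a lift to resolutions, so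
cocycles can be compared without an isomorphism between the models. -/
lemma ofCocycles_naturality {X' : ModuleCat.{u} R} (P' : ProjectiveResolution X') (g : X' ⟶ X)
    (φ : ProjectiveResolution.Hom P' P g) (z) :
    ∃ z', toCochains P' Y n z' = φ.hom.f n ≫ toCochains P Y n z ∧
      ofCocycles P' Y n z' = ((Ext R (ModuleCat.{u} R) n).map g.op).app Y (ofCocycles P Y n z) := by
  let Φ := (((linearYoneda R (ModuleCat.{u} R)).obj Y).rightOp.mapHomologicalComplex _).map φ.hom
  refine ⟨(opcyclesMap Φ n).unop z, ?_, ?_⟩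
  · have := congrArg (fun f => f.unop z) (p_opcyclesMap Φ n)
    exact this
  · have h1 := congrArg (fun f => f.unop z) (homologyι_naturality Φ n)
    have h2 := congrArg (fun f => f.unop
        (((homComplex P Y).homologyι n).unop z)) (P'.isoLeftDerivedObj_hom_naturality g P φ.hom
      (by simpa using φ.hom_f_zero_comp_π_f_zero)
      ((linearYoneda R (ModuleCat.{u} R)).obj Y).rightOp n)
    exact (congrArg (homologyIso P' Y n).hom h1).symm.trans h2.symm

end DerivedExt

end

/-! ### Vanishing of local cohomology in terms of Ext -/

section

open Limits Opposite HomologicalComplex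

variable {R : Type u} [CommRing R]

namespace DerivedExt

lemma extMk_zero_eq_zero_iff {X : ModuleCat.{u} R} (P : ProjectiveResolution X)
    (Y : ModuleCat.{u} R) (f : P.complex.X 0 ⟶ Y) (hf : P.complex.d 1 0 ≫ f = 0) :
    P.extMk f 1 rfl hf = 0 ↔ f = 0 := by
  refine ⟨fun h ↦ ?_, fun h ↦ by subst h; simp⟩
  rw [← P.extEquivCohomologyClass.apply_eq_iff_eq,
    ProjectiveResolution.extEquivCohomologyClass_extMk,
    ProjectiveResolution.extEquivCohomologyClass_zero,
    CochainComplex.HomComplex.CohomologyClass.mk_eq_zero_iff,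
    CochainComplex.HomComplex.Cocycle.toSingleMk_mem_coboundaries_iff _ _ _ _ _ 1 (by simp)] at h
  obtain ⟨g, hg⟩ := h
  -- The resolution sits in nonpositive cohomological degrees, so there are no nonzero coboundaries
  -- in degree 0.
  have hz : IsZero (P.cochainComplex.X 1) := by
    exact CochainComplex.isZero_of_isStrictlyLE _ 0 _
  rw [hz.eq_of_src g 0, comp_zero] at hg
  rw [← cancel_epi (P.cochainComplexXIso (-0) 0 rfl).hom]
  exact hg.symm.trans comp_zero.symm

lemma ofCocycles_eq_zero_iff_extMk {X : ModuleCat.{u} R} (P : ProjectiveResolution X)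
    (Y : ModuleCat.{u} R) (n : ℕ) (z) : ofCocycles P Y n z = 0 ↔
      P.extMk (toCochains P Y n z) (n + 1) rfl (d_comp_toCochains P Y n z) = 0 := by
  obtain _ | p := n
  · rw [ofCocycles_zero_eq_zero_iff, extMk_zero_eq_zero_iff]
    exact (map_eq_zero_iff _ (toCochains_injective P Y 0)).symm
  · rw [ofCocycles_eq_zero_iff P Y (p + 1) p rfl, P.extMk_eq_zero_iff _ _ _ _ p rfl]

end DerivedExt

/-- The projection `R ⧸ J ⟶ R ⧸ J'` for `J ≤ J'`. -/
def quotProj {J J' : Ideal R} (h : J ≤ J') : ModuleCat.of R (R ⧸ J) ⟶ ModuleCat.of R (R ⧸ J') :=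
  ModuleCat.ofHom (Submodule.mapQ J J' LinearMap.id h)

/-- The colimit over `t` of `Ext^k(R ⧸ I ^ t, N)` vanishes. -/
def LocalExtVanish (I : Ideal R) (k : ℕ) (N : Type u) [AddCommGroup N] [Module R N] : Prop :=
  ∀ (t : ℕ) (e : Abelian.Ext (ModuleCat.of R (R ⧸ I ^ t)) (ModuleCat.of R N) k),
    ∃ (s : ℕ) (h : t ≤ s), (Abelian.Ext.mk₀ (quotProj (Ideal.pow_le_pow_right h))).comp e
      (zero_add k) = 0

/-- Evaluation at `N` and the forgetful functor preserve filtered colimits, so an element dies in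
the colimit exactly when it dies at some stage. -/
lemma isZero_colimit_obj_iff {J : Type} [SmallCategory J] [IsFiltered J]
    (F : J ⥤ ModuleCat.{u} R ⥤ ModuleCat.{u} R) (N : ModuleCat.{u} R) :
    IsZero ((colimit F).obj N) ↔
      ∀ (j : J) (x : (F.obj j).obj N), ∃ (i : J) (f : j ⟶ i), (F.map f).app N x = 0 := by
  have : PreservesFilteredColimitsOfSize.{0, 0} (forget (ModuleCat.{u} R)) :=
    preservesSmallestFilteredColimits_of_preservesFilteredColimits.{u, u} _
  have : PreservesColimitsOfShape J (forget (ModuleCat.{u} R)) := inferInstance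
  have hc := isColimitOfPreserves ((evaluation (ModuleCat.{u} R) (ModuleCat.{u} R)).obj N)
    (colimit.isColimit F)
  constructor
  · intro h j x
    have : ((colimit.ι F j).app N) x = ((colimit.ι F j).app N) 0 :=
      @Subsingleton.elim _ (ModuleCat.subsingleton_of_isZero h) _ _
    obtain ⟨i, f, g, hfg⟩ := Concrete.isColimit_exists_of_rep_eq _ hc x 0 this
    exact ⟨i, f, hfg.trans (map_zero _)⟩
  · intro h
    suffices Subsingleton ((colimit F).obj N) from ModuleCat.isZero_of_subsingleton _
    refine subsingleton_of_forall_eq 0 fun y ↦ ?_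
    obtain ⟨j, x, rfl⟩ := Concrete.isColimit_exists_rep _ hc y
    obtain ⟨i, f, hf⟩ := h j x
    have := congrArg (fun φ => φ.app N x) (colimit.w F f)
    refine Eq.trans this.symm ?_
    change (colimit.ι F i).app N ((F.map f).app N x) = 0
    rw [hf, map_zero]

theorem isZero_localCohomology_iff (I : Ideal R) (k : ℕ) (N : Type u) [AddCommGroup N]
    [Module R N] : IsZero ((localCohomology I k).obj (ModuleCat.of R N)) ↔ LocalExtVanish I k N := by
  refine (isZero_colimit_obj_iff _ _).trans ?_
  constructor
  · intro h t e
    let P (t) := projectiveResolution (ModuleCat.of R (R ⧸ I ^ t))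
    obtain ⟨f, hf, rfl⟩ := (P t).extMk_surjective e (k + 1) rfl
    obtain ⟨z, rfl⟩ := DerivedExt.exists_toCochains _ _ _ f hf
    obtain ⟨⟨⟨s⟩⟩, g, hg⟩ := h (op (op t)) (DerivedExt.ofCocycles (P t) _ k z)
    have hts : t ≤ s := leOfHom g.unop.unop
    refine ⟨s, hts, ?_⟩
    let φ : ProjectiveResolution.Hom (P s) (P t) (quotProj (Ideal.pow_le_pow_right hts)) :=
      ⟨ProjectiveResolution.lift (quotProj (Ideal.pow_le_pow_right hts)) _ _, by
        simpa using ProjectiveResolution.lift_commutes_zero _ _ _⟩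
    obtain ⟨z', h1, h2⟩ := DerivedExt.ofCocycles_naturality (P t) (ModuleCat.of R N) k (P s) _ φ z
    rw [ProjectiveResolution.mk₀_comp_extMk _ _ _ _ φ]
    have := (DerivedExt.ofCocycles_eq_zero_iff_extMk _ _ _ z').1 (h2.trans hg)
    simpa only [h1] using this
  · rintro h ⟨⟨t⟩⟩ x
    let P (t) := projectiveResolution (ModuleCat.of R (R ⧸ I ^ t))
    obtain ⟨z, rfl⟩ := DerivedExt.ofCocycles_surjective (P t) _ k x
    obtain ⟨s, hts, hs⟩ := h t ((P t).extMk _ (k + 1) rfl (DerivedExt.d_comp_toCochains (P t) _ k z))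
    let φ : ProjectiveResolution.Hom (P s) (P t) (quotProj (Ideal.pow_le_pow_right hts)) :=
      ⟨ProjectiveResolution.lift (quotProj (Ideal.pow_le_pow_right hts)) _ _, by
        simpa using ProjectiveResolution.lift_commutes_zero _ _ _⟩
    refine ⟨op (op s), (homOfLE hts).op.op, ?_⟩
    obtain ⟨z', h1, h2⟩ := DerivedExt.ofCocycles_naturality (P t) (ModuleCat.of R N) k (P s) _ φ z
    rw [ProjectiveResolution.mk₀_comp_extMk _ _ _ _ φ] at hs
    refine h2.symm.trans ((DerivedExt.ofCocycles_eq_zero_iff_extMk _ _ _ z').2 ?_)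
    simpa only [h1] using hs

end

/-! ### Long exact sequences and power torsion -/

section

open Limits Abelian

variable {R : Type u} [CommRing R]

lemma quotProj_comp {J J' J'' : Ideal R} (h : J ≤ J') (h' : J' ≤ J'') :
    quotProj h ≫ quotProj h' = quotProj (h.trans h') := by
  ext
  rfl

section ShortExact

variable {A B C : Type u} [AddCommGroup A] [AddCommGroup B] [AddCommGroup C]
  [Module R A] [Module R B] [Module R C] {f : A →ₗ[R] B} {g : B →ₗ[R] C}

lemma shortExact_of_exact (hf : Function.Injective f) (hg : Function.Surjective g)
    (hfg : Function.Exact f g) :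
    (ModuleCat.shortComplexOfCompEqZero f g hfg.linearMap_comp_eq_zero).ShortExact :=
  ModuleCat.shortComplex_shortExact _ hfg hf hg

namespace LocalExtVanish

variable {I : Ideal R} {k : ℕ}

/-- A class is pulled back to R/I^s until its image dies, lifted by exactness of Ext, and the lift
is then killed at a further stage; `right` and `left` follow the same pattern. -/
lemma middle (hf : Function.Injective f) (hg : Function.Surjective g)
    (hfg : Function.Exact f g) (hA : LocalExtVanish I k A) (hC : LocalExtVanish I k C) :
    LocalExtVanish I k B := by
  have hS := shortExact_of_exact hf hg hfg
  intro t e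
  obtain ⟨s, hts, hs⟩ := hC t (e.comp (Ext.mk₀ (ModuleCat.ofHom g)) (add_zero k))
  rw [← Ext.comp_assoc_of_third_deg_zero] at hs
  obtain ⟨a, ha⟩ := Ext.covariant_sequence_exact₂ _ hS _ hs
  obtain ⟨r, hsr, hr⟩ := hA s a
  refine ⟨r, hts.trans hsr, ?_⟩
  rw [← quotProj_comp (Ideal.pow_le_pow_right hsr) (Ideal.pow_le_pow_right hts),
    ← Ext.mk₀_comp_mk₀_assoc, ← ha,
    ← Ext.comp_assoc_of_third_deg_zero, hr, Ext.zero_comp]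

lemma right (hf : Function.Injective f) (hg : Function.Surjective g)
    (hfg : Function.Exact f g) (hB : LocalExtVanish I k B) (hA : LocalExtVanish I (k + 1) A) :
    LocalExtVanish I k C := by
  have hS := shortExact_of_exact hf hg hfg
  intro t e
  obtain ⟨s, hts, hs⟩ := hA t (e.comp hS.extClass rfl)
  rw [← Ext.comp_assoc _ _ _ (zero_add k) rfl (by omega)] at hs
  obtain ⟨a, ha⟩ := Ext.covariant_sequence_exact₃ _ hS _ _ hs
  obtain ⟨r, hsr, hr⟩ := hB s a
  refine ⟨r, hts.trans hsr, ?_⟩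
  rw [← quotProj_comp (Ideal.pow_le_pow_right hsr) (Ideal.pow_le_pow_right hts),
    ← Ext.mk₀_comp_mk₀_assoc, ← ha,
    ← Ext.comp_assoc_of_third_deg_zero, hr, Ext.zero_comp]

lemma left (hf : Function.Injective f) (hg : Function.Surjective g)
    (hfg : Function.Exact f g) (hC : LocalExtVanish I k C) (hB : LocalExtVanish I (k + 1) B) :
    LocalExtVanish I (k + 1) A := by
  have hS := shortExact_of_exact hf hg hfg
  intro t e
  obtain ⟨s, hts, hs⟩ := hB t (e.comp (Ext.mk₀ (ModuleCat.ofHom f)) (add_zero _))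
  rw [← Ext.comp_assoc_of_third_deg_zero] at hs
  obtain ⟨a, ha⟩ := Ext.covariant_sequence_exact₁ _ hS _ hs rfl
  obtain ⟨r, hsr, hr⟩ := hC s a
  refine ⟨r, hts.trans hsr, ?_⟩
  rw [← quotProj_comp (Ideal.pow_le_pow_right hsr) (Ideal.pow_le_pow_right hts),
    ← Ext.mk₀_comp_mk₀_assoc, ← ha,
    ← Ext.comp_assoc _ _ _ (zero_add k) rfl (by omega), hr, Ext.zero_comp]

end LocalExtVanish

end ShortExact

/-- The `I`-power torsion submodule `Γ_I(N)`. -/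
def powTorsion (I : Ideal R) (N : Type u) [AddCommGroup N] [Module R N] : Submodule R N where
  carrier := {x | ∃ t : ℕ, ∀ a ∈ I ^ t, a • x = 0}
  zero_mem' := ⟨0, by simp⟩
  add_mem' := by
    rintro x y ⟨s, hs⟩ ⟨t, ht⟩
    refine ⟨max s t, fun a ha ↦ ?_⟩
    rw [smul_add, hs a (Ideal.pow_le_pow_right (le_max_left _ _) ha),
      ht a (Ideal.pow_le_pow_right (le_max_right _ _) ha), add_zero]
  smul_mem' := by
    rintro c x ⟨s, hs⟩
    exact ⟨s, fun a ha ↦ by rw [smul_comm, hs a ha, smul_zero]⟩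

section Torsion

variable (I : Ideal R) {N E : Type u} [AddCommGroup N] [Module R N] [AddCommGroup E] [Module R E]

variable {I} in
lemma mem_powTorsion {x : N} : x ∈ powTorsion I N ↔ ∃ t : ℕ, ∀ a ∈ I ^ t, a • x = 0 := Iff.rfl

lemma powTorsion_powTorsion : powTorsion I (powTorsion I N) = ⊤ := by
  refine eq_top_iff.2 fun x _ ↦ ?_
  obtain ⟨t, ht⟩ := mem_powTorsion.1 x.2
  exact mem_powTorsion.2 ⟨t, fun a ha ↦ Subtype.ext (ht a ha)⟩

lemma powTorsion_eq_top_of_surjective {f : N →ₗ[R] E} (hf : Function.Surjective f)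
    (h : powTorsion I N = ⊤) : powTorsion I E = ⊤ := by
  refine eq_top_iff.2 fun y _ ↦ ?_
  obtain ⟨x, rfl⟩ := hf y
  obtain ⟨t, ht⟩ := mem_powTorsion.1 (h ▸ Submodule.mem_top : x ∈ powTorsion I N)
  exact mem_powTorsion.2 ⟨t, fun a ha ↦ by rw [← map_smul, ht a ha, map_zero]⟩

variable {I} in
lemma exists_forall_pow_smul_eq_zero {s : Submodule R N} (hs : s.FG) (h : s ≤ powTorsion I N) :
    ∃ t : ℕ, ∀ a ∈ I ^ t, ∀ x ∈ s, a • x = 0 := by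
  induction s, hs using Submodule.fg_induction with
  | singleton x =>
    obtain ⟨t, ht⟩ := mem_powTorsion.1 (h (Submodule.mem_span_singleton_self x))
    refine ⟨t, fun a ha y hy ↦ ?_⟩
    obtain ⟨c, rfl⟩ := Submodule.mem_span_singleton.1 hy
    rw [smul_comm, ht a ha, smul_zero]
  | sup M₁ M₂ _ _ h₁ h₂ =>
    obtain ⟨t₁, ht₁⟩ := h₁ (le_sup_left.trans h)
    obtain ⟨t₂, ht₂⟩ := h₂ (le_sup_right.trans h)
    refine ⟨max t₁ t₂, fun a ha x hx ↦ ?_⟩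
    obtain ⟨y, hy, z, hz, rfl⟩ := Submodule.mem_sup.1 hx
    rw [smul_add, ht₁ a (Ideal.pow_le_pow_right (le_max_left _ _) ha) y hy,
      ht₂ a (Ideal.pow_le_pow_right (le_max_right _ _) ha) z hz, add_zero]

/-- If I^t x is torsion, then, being finitely generated, it is killed by a single I^s, so I^(s+t)
kills x. -/
lemma powTorsion_quotient [IsNoetherianRing R] : powTorsion I (N ⧸ powTorsion I N) = ⊥ := by
  refine eq_bot_iff.2 fun y hy ↦ ?_
  obtain ⟨x, rfl⟩ := Submodule.mkQ_surjective _ y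
  obtain ⟨t, ht⟩ := mem_powTorsion.1 hy
  obtain ⟨s, hs⟩ := exists_forall_pow_smul_eq_zero (I := I)
    (s := Submodule.map (LinearMap.toSpanSingleton R N x) (I ^ t))
    (Submodule.FG.map _ (IsNoetherian.noetherian _)) (by
      rintro _ ⟨a, ha, rfl⟩
      exact (Submodule.Quotient.mk_eq_zero _).1 (ht a ha))
  refine (Submodule.mem_bot R).2 ((Submodule.Quotient.mk_eq_zero _).2 ⟨s + t, fun a ha ↦ ?_⟩)
  rw [pow_add] at ha
  induction ha using Submodule.mul_induction_on' with
  | mem_mul_mem b hb c hc =>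
    rw [mul_smul]
    exact hs b hb _ ⟨c, hc, rfl⟩
  | add b _ c _ hb hc => rw [add_smul, hb, hc, add_zero]

/-- Baer's criterion with Artin–Rees: if I^s kills the image of g on J, then g vanishes on I^(k+s) ∩
J ⊆ I^s J. Hence g factors through a submodule of R/I^(k+s), and any extension of it to `E` has
torsion values. -/
theorem injective_powTorsion [IsNoetherianRing R] [Module.Injective R E] :
    Module.Injective R (powTorsion I E) := by
  refine Module.Baer.injective fun J g ↦ ?_
  have hJ : J.FG := IsNoetherian.noetherian J
  obtain ⟨s, hs⟩ := exists_forall_pow_smul_eq_zero (I := I)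
    (s := LinearMap.range ((powTorsion I E).subtype ∘ₗ g))
    (by
      rw [LinearMap.range_eq_map]
      exact Submodule.FG.map _ (IsNoetherian.noetherian _)) (by
      rintro _ ⟨a, rfl⟩
      exact (g a).2)
  obtain ⟨k, hk⟩ := I.exists_pow_inf_eq_pow_smul (J : Submodule R R)
  have hAR : I ^ (k + s) ⊓ J ≤ I ^ s * J := by
    have := hk (k + s) (Nat.le_add_right _ _)
    simp only [smul_eq_mul, Ideal.mul_top, Nat.add_sub_cancel_left] at this
    rw [this]
    exact Ideal.mul_mono_right inf_le_right
  have hg : ∀ x (hx : x ∈ J), x ∈ I ^ (k + s) → (g ⟨x, hx⟩ : E) = 0 := by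
    suffices ∀ x ∈ I ^ s * J, ∃ hx : x ∈ J, (g ⟨x, hx⟩ : E) = 0 from
      fun x hx hx' ↦ (this x (hAR ⟨hx', hx⟩)).2
    intro x hx
    induction hx using Submodule.mul_induction_on' with
    | mem_mul_mem b hb c hc =>
      refine ⟨J.mul_mem_left b hc, ?_⟩
      have := hs b hb _ ⟨⟨c, hc⟩, rfl⟩
      rw [← map_smul] at this
      exact this
    | add b _ c _ hb hc =>
      obtain ⟨hb, hb'⟩ := hb
      obtain ⟨hc, hc'⟩ := hc
      refine ⟨J.add_mem hb hc, ?_⟩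
      have : (⟨b + c, J.add_mem hb hc⟩ : J) = ⟨b, hb⟩ + ⟨c, hc⟩ := rfl
      rw [this, map_add, Submodule.coe_add, hb', hc', add_zero]
  let K : Submodule R J := Submodule.comap (Submodule.subtype J) (I ^ (k + s))
  let ψ : (J ⧸ K) →ₗ[R] E := K.liftQ ((powTorsion I E).subtype ∘ₗ g) fun x hx ↦ hg x x.2 hx
  let i : (J ⧸ K) →ₗ[R] (R ⧸ I ^ (k + s)) := K.mapQ (I ^ (k + s)) (Submodule.subtype J) le_rfl
  have hi : Function.Injective i := by
    refine (injective_iff_map_eq_zero _).2 fun y hy ↦ ?_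
    obtain ⟨x, rfl⟩ := Submodule.mkQ_surjective _ y
    exact (Submodule.Quotient.mk_eq_zero K).2 ((Submodule.Quotient.mk_eq_zero (I ^ (k + s))).1 hy)
  obtain ⟨h, hh⟩ := Module.Injective.out i hi ψ
  have he : h (Submodule.Quotient.mk 1) ∈ powTorsion I E := ⟨k + s, fun a ha ↦ by
    rw [← map_smul, ← Submodule.Quotient.mk_smul, smul_eq_mul, mul_one,
      (Submodule.Quotient.mk_eq_zero _).2 ha, map_zero]⟩
  refine ⟨LinearMap.toSpanSingleton R _ ⟨_, he⟩, fun x hx ↦ Subtype.ext ?_⟩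
  have := hh (Submodule.Quotient.mk ⟨x, hx⟩)
  refine Eq.trans ?_ this
  change x • h _ = h (Submodule.Quotient.mk x)
  rw [← map_smul, ← Submodule.Quotient.mk_smul, smul_eq_mul, mul_one]

variable (R N) in
lemma exists_module_injective : ∃ (E : Type u) (_ : AddCommGroup E) (_ : Module R E)
    (ι : N →ₗ[R] E), Module.Injective R E ∧ Function.Injective ι := by
  let E : ModuleCat.{u} R := CategoryTheory.Injective.under (ModuleCat.of R N)
  let j : ModuleCat.of R N ⟶ E := CategoryTheory.Injective.ι (ModuleCat.of R N)
  have : CategoryTheory.Injective (ModuleCat.of R E) :=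
    inferInstanceAs (CategoryTheory.Injective (CategoryTheory.Injective.under (ModuleCat.of R N)))
  exact ⟨E, inferInstance, inferInstance, j.hom,
    Module.injective_module_of_injective_object R _,
    (ModuleCat.mono_iff_injective _).1 inferInstance⟩

/-- The injective submodule Γ_I(E) splits off `E`; its complement is injective and torsion-free, and
a torsion-free `N` still embeds there because it meets Γ_I(E) trivially. -/
theorem exists_injective_powTorsion_eq_bot [IsNoetherianRing R] (h : powTorsion I N = ⊥) :
    ∃ (B : Type u) (_ : AddCommGroup B) (_ : Module R B) (ι : N →ₗ[R] B),
      Module.Injective R B ∧ powTorsion I B = ⊥ ∧ Function.Injective ι := by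
  obtain ⟨E, _, _, j, _, hj⟩ := exists_module_injective R N
  have := injective_powTorsion I (E := E)
  obtain ⟨r, hr⟩ := Module.Injective.out (powTorsion I E).subtype
    (Submodule.subtype_injective _) LinearMap.id
  let p : E →ₗ[R] LinearMap.ker r :=
    (LinearMap.id - (powTorsion I E).subtype ∘ₗ r).codRestrict _ fun x ↦ by
      have := hr (r x)
      simp_all
  have hp (x) : (p x : E) = x - r x := rfl
  refine ⟨LinearMap.ker r, inferInstance, inferInstance, p ∘ₗ j, ⟨?_⟩, ?_, ?_⟩
  · intro X Y _ _ _ _ f hf g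
    obtain ⟨h, hh⟩ := Module.Injective.out f hf ((LinearMap.ker r).subtype ∘ₗ g)
    refine ⟨p ∘ₗ h, fun x ↦ Subtype.ext ?_⟩
    have h0 : r (g x) = 0 := (g x).2
    change (p (h (f x)) : E) = g x
    rw [hp, hh]
    simp [h0]
  · refine eq_bot_iff.2 fun x hx ↦ ?_
    obtain ⟨t, ht⟩ := hx
    have hx' : (x : E) ∈ powTorsion I E := ⟨t, fun a ha ↦ congrArg Subtype.val (ht a ha)⟩
    have h1 : r x = ⟨x, hx'⟩ := hr ⟨x, hx'⟩
    have h0 : r x = 0 := x.2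
    rw [h0] at h1
    exact (Submodule.mem_bot R).2 (Subtype.ext (congrArg Subtype.val h1).symm)
  · refine (injective_iff_map_eq_zero _).2 fun x hx ↦ ?_
    have h1 : j x = r (j x) := sub_eq_zero.1 (congrArg Subtype.val hx)
    obtain ⟨t, ht⟩ := (r (j x)).2
    have : x ∈ powTorsion I N := ⟨t, fun a ha ↦ hj (by rw [map_smul, h1, ht a ha, map_zero])⟩
    rwa [h, Submodule.mem_bot] at this

theorem exists_injective_powTorsion_eq_top [IsNoetherianRing R] (h : powTorsion I N = ⊤) :
    ∃ (B : Type u) (_ : AddCommGroup B) (_ : Module R B) (ι : N →ₗ[R] B),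
      Module.Injective R B ∧ powTorsion I B = ⊤ ∧ Function.Injective ι := by
  obtain ⟨E, _, _, j, _, hj⟩ := exists_module_injective R N
  refine ⟨powTorsion I E, inferInstance, inferInstance, j.codRestrict _ fun x ↦ ?_,
    injective_powTorsion I, powTorsion_powTorsion I, ?_⟩
  · obtain ⟨t, ht⟩ := mem_powTorsion.1 (h ▸ Submodule.mem_top : x ∈ powTorsion I N)
    exact ⟨t, fun a ha ↦ by rw [← map_smul, ht a ha, map_zero]⟩
  · exact fun x y hxy ↦ hj (congrArg Subtype.val hxy)

end Torsion

end

/-! ### Vanishing theorems by dimension shifting -/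

section

open Limits Abelian

variable {R : Type u} [CommRing R]

section Vanishing

variable {I : Ideal R} {N L : Type u} [AddCommGroup N] [Module R N] [AddCommGroup L] [Module R L]

lemma ext_eq_zero_of_injective [Module.Injective R N] {X : ModuleCat.{u} R} {k : ℕ}
    (e : Ext X (ModuleCat.of R N) (k + 1)) : e = 0 := by
  have := Module.injective_object_of_injective_module R N
  exact Ext.eq_zero_of_injective e

lemma ext_zero_eq_zero {X : ModuleCat.{u} R} {t : ℕ}
    (hX : ∀ a ∈ I ^ t, ∀ x : X, a • x = 0) (hN : powTorsion I N = ⊥)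
    (e : Ext X (ModuleCat.of R N) 0) : e = 0 := by
  obtain ⟨f, rfl⟩ := Ext.mk₀_bijective _ _ |>.2 e
  suffices f = 0 by rw [this, Ext.mk₀_zero]
  ext x
  have : f x ∈ powTorsion I N := ⟨t, fun a ha ↦ by
    rw [← map_smul]
    exact (congrArg _ (hX a ha x)).trans (map_zero _)⟩
  rwa [hN, Submodule.mem_bot] at this

lemma pow_smul_quotient (t : ℕ) : ∀ a ∈ I ^ t, ∀ x : R ⧸ I ^ t, a • x = 0 := by
  intro a ha x
  obtain ⟨y, rfl⟩ := Submodule.mkQ_surjective _ x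
  exact (Submodule.Quotient.mk_eq_zero (I ^ t)).2 ((I ^ t).mul_mem_right y ha)

lemma LocalExtVanish.of_eq_zero {k : ℕ}
    (h : ∀ t, ∀ e : Ext (ModuleCat.of R (R ⧸ I ^ t)) (ModuleCat.of R N) k, e = 0) :
    LocalExtVanish I k N :=
  fun t e ↦ ⟨t, le_rfl, by rw [h t e, Ext.comp_zero]⟩

lemma LocalExtVanish.of_injective_succ [Module.Injective R N] (k : ℕ) :
    LocalExtVanish I (k + 1) N :=
  .of_eq_zero fun _ ↦ ext_eq_zero_of_injective

lemma localExtVanish_zero_iff : LocalExtVanish I 0 N ↔ powTorsion I N = ⊥ := by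
  refine ⟨fun h ↦ eq_bot_iff.2 ?_, fun h ↦ .of_eq_zero fun t ↦
    ext_zero_eq_zero (pow_smul_quotient t) h⟩
  rintro x ⟨t, ht⟩
  let f : (R ⧸ I ^ t) →ₗ[R] N := (I ^ t).liftQ (LinearMap.toSpanSingleton R N x) ht
  obtain ⟨s, hts, hs⟩ := h t (Ext.mk₀ (ModuleCat.ofHom f))
  rw [Ext.mk₀_comp_mk₀, Ext.mk₀_eq_zero_iff] at hs
  have := congrArg (fun φ => φ.hom (Submodule.Quotient.mk 1)) hs
  exact (Submodule.mem_bot R).2 ((one_smul R x).symm.trans this)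

lemma LocalExtVanish.of_injective [Module.Injective R N] (h : powTorsion I N = ⊥) (k : ℕ) :
    LocalExtVanish I k N := by
  cases k with
  | zero => exact localExtVanish_zero_iff.2 h
  | succ k => exact of_injective_succ k

/-- If the local cohomology of `N` vanishes up to degree `k`, then so does `Ext(T, N)`
for `T` killed by a power of `I`. -/
theorem ext_eq_zero_of_localExtVanish [IsNoetherianRing R] {T : ModuleCat.{u} R} {t : ℕ}
    (hT : ∀ a ∈ I ^ t, ∀ x : T, a • x = 0) {k : ℕ} (h : ∀ i ≤ k, LocalExtVanish I i N)
    (e : Ext T (ModuleCat.of R N) k) : e = 0 := by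
  induction k generalizing N with
  | zero => exact ext_zero_eq_zero hT (localExtVanish_zero_iff.1 (h 0 le_rfl)) e
  | succ k ih =>
    -- A torsion-free injective module has no local cohomology at all, so passing to the cokernel
    -- lowers every degree by one.
    obtain ⟨B, _, _, ι, _, hB, hι⟩ := exists_injective_powTorsion_eq_bot I
      (localExtVanish_zero_iff.1 (h 0 (Nat.zero_le _)))
    have hex := LinearMap.exact_map_mkQ_range ι
    obtain ⟨x, rfl⟩ := Ext.covariant_sequence_exact₁ T
      (shortExact_of_exact hι (Submodule.mkQ_surjective _) hex) e (ext_eq_zero_of_injective _) rfl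
    have : x = 0 := ih (fun i hi ↦ .right hι (Submodule.mkQ_surjective _) hex
      (.of_injective hB i) (h (i + 1) (by omega))) x
    rw [this, Ext.zero_comp]

/-- `N` embeds in a torsion injective `B`, and B/N is again torsion, which gives the induction. In
degree 1 a class comes from a map R/I^t → B/N; a preimage b of the image of 1 is killed by some I^s,
so the map lifts to `B` after pulling back to R/I^(max t s). -/
theorem LocalExtVanish.of_powTorsion_eq_top [IsNoetherianRing R] (h : powTorsion I N = ⊤)
    (k : ℕ) : LocalExtVanish I (k + 1) N := by
  induction k generalizing N with
  | zero =>
    obtain ⟨B, _, _, ι, _, hB, hι⟩ := exists_injective_powTorsion_eq_top I h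
    have hex := LinearMap.exact_map_mkQ_range ι
    have hS := shortExact_of_exact hι (Submodule.mkQ_surjective _) hex
    intro t e
    obtain ⟨x, rfl⟩ := Ext.covariant_sequence_exact₁ _ hS e (ext_eq_zero_of_injective _) rfl
    obtain ⟨φ, rfl⟩ := Ext.mk₀_bijective _ _ |>.2 x
    obtain ⟨b, hb⟩ := Submodule.mkQ_surjective _ (φ.hom (Submodule.Quotient.mk 1))
    obtain ⟨s, hs⟩ := mem_powTorsion.1 (hB ▸ Submodule.mem_top : b ∈ powTorsion I B)
    let ψ : (R ⧸ I ^ (max t s)) →ₗ[R] B := (I ^ (max t s)).liftQ (LinearMap.toSpanSingleton R B b)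
      fun a ha ↦ hs a (Ideal.pow_le_pow_right (le_max_right _ _) ha)
    refine ⟨max t s, le_max_left _ _, ?_⟩
    have : quotProj (Ideal.pow_le_pow_right (le_max_left t s)) ≫ φ =
        ModuleCat.ofHom ψ ≫ ModuleCat.ofHom (LinearMap.range ι).mkQ := by
      apply ModuleCat.hom_ext
      apply Submodule.linearMap_qext
      apply LinearMap.ext_ring
      change φ.hom (Submodule.Quotient.mk 1) = (LinearMap.range ι).mkQ ((1 : R) • b)
      rw [one_smul, hb]
    rw [Ext.mk₀_comp_mk₀_assoc, this, ← Ext.mk₀_comp_mk₀_assoc]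
    have h0 : (Ext.mk₀ (ModuleCat.ofHom (LinearMap.range ι).mkQ)).comp hS.extClass (zero_add 1) = 0 :=
      hS.comp_extClass
    rw [h0, Ext.comp_zero]
  | succ k ih =>
    obtain ⟨B, _, _, ι, _, hB, hι⟩ := exists_injective_powTorsion_eq_top I h
    have hex := LinearMap.exact_map_mkQ_range ι
    exact .left hι (Submodule.mkQ_surjective _) hex
      (ih (powTorsion_eq_top_of_surjective I (Submodule.mkQ_surjective _) hB))
      (.of_injective_succ _)

/-- A map from a module with local cohomology in degrees `< d` to a module with local cohomology
in degrees `≥ d` induces zero on `Ext(T, -)` for every `T` killed by a power of `I`. -/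
theorem ext_comp_mk₀_eq_zero [IsNoetherianRing R] {T : ModuleCat.{u} R} {t : ℕ}
    (hT : ∀ a ∈ I ^ t, ∀ x : T, a • x = 0) {d : ℕ} (hN : ∀ k, d ≤ k → LocalExtVanish I k N)
    (hL : ∀ k < d, LocalExtVanish I k L) (f : N →ₗ[R] L) {j : ℕ}
    (e : Ext T (ModuleCat.of R N) j) : e.comp (Ext.mk₀ (ModuleCat.ofHom f)) (add_zero j) = 0 := by
  induction d generalizing N L j with
  | zero =>
    rw [ext_eq_zero_of_localExtVanish hT (fun i _ ↦ hN i (Nat.zero_le _)) e, Ext.zero_comp]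
  | succ d ih =>
    have hL0 := localExtVanish_zero_iff.1 (hL 0 d.succ_pos)
    -- As `L` is torsion-free, f factors through N/Γ, which stays without local cohomology in
    -- degrees ≥ d + 1 because `Γ` has none in positive degrees.
    let Γ := powTorsion I N
    have hΓ : Γ ≤ LinearMap.ker f := by
      rintro x ⟨s, hs⟩
      have : f x ∈ powTorsion I L := ⟨s, fun a ha ↦ by rw [← map_smul, hs a ha, map_zero]⟩
      rwa [hL0, Submodule.mem_bot] at this
    let g : (N ⧸ Γ) →ₗ[R] L := Γ.liftQ f hΓ
    have hfg : ModuleCat.ofHom f = ModuleCat.ofHom Γ.mkQ ≫ ModuleCat.ofHom g := by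
      ext x; rfl
    rw [hfg, ← Ext.mk₀_comp_mk₀, ← Ext.comp_assoc_of_third_deg_zero]
    generalize e.comp (Ext.mk₀ (ModuleCat.ofHom Γ.mkQ)) (add_zero j) = e
    have hΓ0 : powTorsion I (N ⧸ Γ) = ⊥ := powTorsion_quotient I
    have hNΓ : ∀ k, d + 1 ≤ k → LocalExtVanish I k (N ⧸ Γ) := fun k hk ↦
      .right Γ.subtype_injective Γ.mkQ_surjective (LinearMap.exact_subtype_mkQ Γ) (hN k hk)
        (.of_powTorsion_eq_top (powTorsion_powTorsion I) k)
    obtain ⟨B, _, _, ι, _, hB, hι⟩ := exists_injective_powTorsion_eq_bot I hΓ0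
    obtain ⟨E, _, _, ι', _, hE, hι'⟩ := exists_injective_powTorsion_eq_bot I hL0
    -- The extension `G` of g induces `G'` on the cokernels, to which the induction hypothesis
    -- applies with all degrees lowered by one; naturality of the connecting map brings the result
    -- back to g.
    obtain ⟨G, hG⟩ := Module.Injective.out ι hι (ι' ∘ₗ g)
    have hex := LinearMap.exact_map_mkQ_range ι
    have hex' := LinearMap.exact_map_mkQ_range ι'
    have hS := shortExact_of_exact hι (Submodule.mkQ_surjective _) hex
    have hS' := shortExact_of_exact hι' (Submodule.mkQ_surjective _) hex'
    let G' : (B ⧸ LinearMap.range ι) →ₗ[R] (E ⧸ LinearMap.range ι') := Submodule.mapQ _ _ G (by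
      rintro _ ⟨x, rfl⟩
      exact ⟨g x, (hG x).symm⟩)
    cases j with
    | zero => rw [ext_zero_eq_zero hT hΓ0 e, Ext.zero_comp]
    | succ j =>
      obtain ⟨x, rfl⟩ := Ext.covariant_sequence_exact₁ _ hS e (ext_eq_zero_of_injective _) rfl
      let φ : ModuleCat.shortComplexOfCompEqZero ι _ hex.linearMap_comp_eq_zero ⟶
          ModuleCat.shortComplexOfCompEqZero ι' _ hex'.linearMap_comp_eq_zero :=
        { τ₁ := ModuleCat.ofHom g
          τ₂ := ModuleCat.ofHom G
          τ₃ := ModuleCat.ofHom G'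
          comm₁₂ := by ext x; exact (hG (Submodule.Quotient.mk x)).symm
          comm₂₃ := by ext x; rfl }
      have := ShortComplex.ShortExact.extClass_naturality hS hS' φ
      rw [Ext.comp_assoc_of_third_deg_zero]
      refine (congrArg (fun y => x.comp y rfl) this).trans ?_
      have hx : x.comp (Ext.mk₀ (ModuleCat.ofHom G')) (add_zero j) = 0 := ih
        (fun k hk ↦ .right hι (Submodule.mkQ_surjective _) hex (.of_injective hB k)
          (hNΓ _ (by omega)))
        (fun k hk ↦ .right hι' (Submodule.mkQ_surjective _) hex' (.of_injective hE k)
          (hL _ (by omega))) G' x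
      rw [← Ext.comp_assoc _ _ _ (add_zero j) (zero_add 1) (by omega)]
      exact (congrArg (fun y => Ext.comp y hS'.extClass rfl) hx).trans (Ext.zero_comp ..)

end Vanishing

end

/-! ### Top Ext of quotients by powers of variables -/

section

open Limits Abelian

section Koszul

variable {R : Type u} [CommRing R]

/-- The element `x : N`, viewed as a morphism `R ⟶ N`. -/
def elemHom {N : Type u} [AddCommGroup N] [Module R N] (x : N) :
    ModuleCat.of R R ⟶ ModuleCat.of R N :=
  ModuleCat.ofHom (LinearMap.toSpanSingleton R N x)

lemma elemHom_comp {N L : Type u} [AddCommGroup N] [Module R N] [AddCommGroup L] [Module R L]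
    (f : N →ₗ[R] L) (x : N) : elemHom (R := R) x ≫ ModuleCat.ofHom f = elemHom (f x) := by
  apply ModuleCat.hom_ext
  apply LinearMap.ext_ring
  simp [elemHom]

lemma elemHom_sub_smul {N : Type u} [AddCommGroup N] [Module R N] (x y : N) (a : R) :
    elemHom (R := R) (x - a • y) = elemHom x - a • elemHom y := by
  apply ModuleCat.hom_ext
  apply LinearMap.ext_ring
  simp [elemHom]

/-- `Ext^j(R ⧸ J, -)` is a quotient of the identity functor by a subfunctor of `J • -`, and the
higher `Ext` vanish. -/
structure ExtTopDegree (J : Ideal R) (j : ℕ) where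
  vanish : ∀ (N : ModuleCat.{u} R) (i : ℕ), j < i → ∀ e : Ext (ModuleCat.of R (R ⧸ J)) N i, e = 0
  cls : Ext (ModuleCat.of R (R ⧸ J)) (ModuleCat.of R R) j
  surj : ∀ (N : Type u) [AddCommGroup N] [Module R N]
    (e : Ext (ModuleCat.of R (R ⧸ J)) (ModuleCat.of R N) j),
    ∃ x : N, cls.comp (Ext.mk₀ (elemHom x)) (add_zero j) = e
  ker : ∀ (N : Type u) [AddCommGroup N] [Module R N] (x : N),
    cls.comp (Ext.mk₀ (elemHom x)) (add_zero j) = 0 → x ∈ J • (⊤ : Submodule R N)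

theorem extTopDegree_bot : Nonempty (ExtTopDegree (⊥ : Ideal R) 0) := by
  let e : (R ⧸ (⊥ : Ideal R)) ≃ₗ[R] R := Submodule.quotEquivOfEqBot ⊥ rfl
  have : Module.Projective R (R ⧸ (⊥ : Ideal R)) := Module.Projective.of_equiv e.symm
  have : Projective (ModuleCat.of R (R ⧸ (⊥ : Ideal R))) := inferInstance
  refine ⟨⟨fun N i hi x ↦ ?_, Ext.mk₀ (ModuleCat.ofHom e.toLinearMap), ?_, ?_⟩⟩
  · obtain ⟨i, rfl⟩ := Nat.exists_eq_succ_of_ne_zero hi.ne'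
    exact Ext.eq_zero_of_projective x
  · intro N _ _ x
    obtain ⟨f, rfl⟩ := Ext.mk₀_bijective _ _ |>.2 x
    refine ⟨f.hom (e.symm 1), ?_⟩
    rw [Ext.mk₀_comp_mk₀]
    congr 1
    apply ModuleCat.hom_ext
    apply LinearMap.ext fun y ↦ ?_
    obtain ⟨y, rfl⟩ := e.symm.surjective y
    change (e (e.symm y)) • f.hom (e.symm 1) = f.hom (e.symm y)
    rw [← map_smul, ← map_smul]
    simp
  · intro N _ _ x hx
    rw [Ext.mk₀_comp_mk₀, Ext.mk₀_eq_zero_iff] at hx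
    have := congrArg (fun φ => φ.hom (e.symm 1)) hx
    change (e (e.symm 1)) • x = 0 at this
    rw [e.apply_symm_apply, one_smul] at this
    rw [this]
    exact zero_mem _

/-- Multiplication by a on R/J is injective with cokernel R/(J + (a)). As j is the top degree for
R/J, the long exact sequence identifies the next Ext with Ext^j(R/J, N) modulo a. For the kernel: if
the class of x becomes zero, it equals a times the class of some y, so x - ay ∈ JN. -/
theorem ExtTopDegree.succ {J : Ideal R} {j : ℕ} (h : ExtTopDegree J j) {a : R}
    (ha : ∀ r, a * r ∈ J → r ∈ J) : Nonempty (ExtTopDegree (J ⊔ Ideal.span {a}) (j + 1)) := by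
  let J' := J ⊔ Ideal.span {a}
  let m : (R ⧸ J) →ₗ[R] (R ⧸ J) := LinearMap.lsmul R (R ⧸ J) a
  let p : (R ⧸ J) →ₗ[R] (R ⧸ J') := Submodule.mapQ J J' LinearMap.id le_sup_left
  have hm : Function.Injective m := by
    refine (injective_iff_map_eq_zero _).2 fun y hy ↦ ?_
    obtain ⟨x, rfl⟩ := Submodule.mkQ_surjective _ y
    exact (Submodule.Quotient.mk_eq_zero J).2 (ha x ((Submodule.Quotient.mk_eq_zero J).1 hy))
  have hp : Function.Surjective p := fun y ↦ by
    obtain ⟨x, rfl⟩ := Submodule.mkQ_surjective _ y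
    exact ⟨Submodule.Quotient.mk x, rfl⟩
  have hex : Function.Exact m p := by
    intro y
    obtain ⟨x, rfl⟩ := Submodule.mkQ_surjective _ y
    constructor
    · intro hx
      have hx' : x ∈ J' := (Submodule.Quotient.mk_eq_zero J').1 hx
      obtain ⟨u, hu, v, hv, rfl⟩ := Submodule.mem_sup.1 hx'
      obtain ⟨r, rfl⟩ := Ideal.mem_span_singleton.1 hv
      refine ⟨Submodule.Quotient.mk r, ?_⟩
      refine (Submodule.Quotient.eq J).2 ?_
      simpa [smul_eq_mul] using hu
    · rintro ⟨z, hz⟩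
      obtain ⟨r, rfl⟩ := Submodule.mkQ_surjective _ z
      have hJ : a * r - x ∈ J := (Submodule.Quotient.eq J).1 hz
      refine (Submodule.Quotient.mk_eq_zero J').2 ?_
      have := J'.sub_mem (Ideal.mem_sup_right (Ideal.mul_mem_right _ _ (Ideal.mem_span_singleton_self a)) : a * r ∈ J')
        (Ideal.mem_sup_left hJ : a * r - x ∈ J')
      simpa using this
  have hS := shortExact_of_exact hm hp hex
  have lift (N : ModuleCat.{u} R) (i : ℕ) (hi : j ≤ i)
      (e : Ext (ModuleCat.of R (R ⧸ J')) N (i + 1)) :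
      ∃ x : Ext (ModuleCat.of R (R ⧸ J)) N i, hS.extClass.comp x (add_comm 1 i) = e :=
    Ext.contravariant_sequence_exact₃ hS N e (h.vanish _ _ (by omega) _) (add_comm 1 i)
  refine ⟨⟨fun N i hi e ↦ ?_, hS.extClass.comp h.cls (add_comm 1 j), ?_, ?_⟩⟩
  · obtain ⟨i, rfl⟩ := Nat.exists_eq_succ_of_ne_zero (n := i) (by omega)
    obtain ⟨x, rfl⟩ := lift N i (by omega) e
    rw [h.vanish N i (by omega) x, Ext.comp_zero]
  · intro N _ _ e
    obtain ⟨x, rfl⟩ := lift _ j le_rfl e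
    obtain ⟨y, rfl⟩ := h.surj N x
    exact ⟨y, Ext.comp_assoc_of_third_deg_zero ..⟩
  · intro N _ _ x hx
    rw [Ext.comp_assoc_of_third_deg_zero] at hx
    obtain ⟨z, hz⟩ := Ext.contravariant_sequence_exact₁ hS _ _ _ hx
    obtain ⟨y, rfl⟩ := h.surj N z
    have hm' : ModuleCat.ofHom m = a • 𝟙 (ModuleCat.of R (R ⧸ J)) := rfl
    have h1 : a • h.cls.comp (Ext.mk₀ (elemHom y)) (add_zero j) =
        h.cls.comp (Ext.mk₀ (elemHom x)) (add_zero j) := by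
      refine Eq.trans ?_ hz
      change _ = (Ext.mk₀ (ModuleCat.ofHom m)).comp _ _
      rw [hm', Ext.mk₀_smul, Ext.smul_comp, Ext.mk₀_id_comp]
    have h2 : x - a • y ∈ J • (⊤ : Submodule R N) := by
      apply h.ker
      rw [elemHom_sub_smul, sub_eq_add_neg, Ext.mk₀_add, Ext.mk₀_neg, Ext.mk₀_smul, Ext.comp_add,
        Ext.comp_neg, Ext.comp_smul, h1, add_neg_cancel]
    have h3 : a • y ∈ J' • (⊤ : Submodule R N) := Submodule.smul_mem_smul
      (Ideal.mem_sup_right (Ideal.mem_span_singleton_self a)) trivial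
    have := add_mem (Submodule.smul_mono_left le_sup_left h2) h3
    rwa [sub_add_cancel] at this

end Koszul

section MvPolynomial

variable {K : Type u} [Field K] {σ : Type}

open MvPolynomial

/-- The ideal generated by the `t`-th powers of the variables in `s`. -/
def varPowIdeal (K : Type u) [Field K] (s : Finset σ) (t : ℕ) : Ideal (MvPolynomial σ K) :=
  Ideal.span ((fun i ↦ (X i : MvPolynomial σ K) ^ t) '' s)

lemma mem_varPowIdeal {s : Finset σ} {t : ℕ} {p : MvPolynomial σ K} :
    p ∈ varPowIdeal K s t ↔ ∀ m ∈ p.support, ∃ i ∈ s, t ≤ m i := by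
  have : (fun i ↦ (X i : MvPolynomial σ K) ^ t) '' s =
      (fun m ↦ monomial m (1 : K)) '' ((fun i ↦ Finsupp.single i t) '' s) := by
    rw [Set.image_image]
    simp [X_pow_eq_monomial]
  rw [varPowIdeal, this, mem_ideal_span_monomial_image]
  simp

theorem extTopDegree_varPowIdeal (s : Finset σ) (t : ℕ) :
    Nonempty (ExtTopDegree (varPowIdeal K s t) s.card) := by
  classical
  induction s using Finset.induction_on with
  | empty =>
    have : varPowIdeal K (∅ : Finset σ) t = ⊥ := by simp [varPowIdeal]
    rw [this]
    exact extTopDegree_bot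
  | insert i s hi ih =>
    obtain ⟨h⟩ := ih
    have hJ : varPowIdeal K (insert i s) t = varPowIdeal K s t ⊔ Ideal.span {X i ^ t} := by
      rw [varPowIdeal, Finset.coe_insert, Set.image_insert_eq, Ideal.span_insert, sup_comm]
      rfl
    rw [hJ, Finset.card_insert_of_notMem hi]
    -- Multiplying by X_i^t leaves the exponents of the variables in `s` unchanged, so it is
    -- injective modulo their t-th powers.
    refine h.succ fun r hr ↦ ?_
    rw [mem_varPowIdeal] at hr ⊢
    intro m hm
    obtain ⟨l, hl, hlt⟩ := hr (Finsupp.single i t + m) (by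
      rw [X_pow_eq_monomial, mem_support_iff, coeff_monomial_mul]
      simpa using hm)
    refine ⟨l, hl, ?_⟩
    have : i ≠ l := fun h ↦ hi (h ▸ hl)
    simpa [Finsupp.single_apply, this] using hlt

/-- A map from a module with local cohomology in degrees `< d` to a module with local cohomology
in degrees `≥ d` has image in the intersection of the `I ^ t • L`. -/
theorem apply_mem_pow_smul_top [Finite σ] (s : Finset σ) {N L : Type u} [AddCommGroup N] [AddCommGroup L]
    [Module (MvPolynomial σ K) N] [Module (MvPolynomial σ K) L] {d : ℕ}
    (hN : ∀ k, d ≤ k → LocalExtVanish (varPowIdeal K s 1) k N)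
    (hL : ∀ k < d, LocalExtVanish (varPowIdeal K s 1) k L) (f : N →ₗ[MvPolynomial σ K] L)
    (t : ℕ) (x : N) : f x ∈ varPowIdeal K s 1 ^ t • (⊤ : Submodule (MvPolynomial σ K) L) := by
  obtain ⟨h⟩ := extTopDegree_varPowIdeal (K := K) s t
  have hle : varPowIdeal K s t ≤ varPowIdeal K s 1 ^ t := by
    refine Ideal.span_le.2 ?_
    rintro _ ⟨i, hi, rfl⟩
    refine Ideal.pow_mem_pow ?_ t
    rw [mem_varPowIdeal]
    intro m hm
    rw [support_X, Finset.mem_singleton] at hm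
    exact ⟨i, hi, by simp [hm]⟩
  -- This makes the quotient by the t-th powers of the variables a legitimate T for
  -- `ext_comp_mk₀_eq_zero`.
  obtain ⟨m, hm⟩ : ∃ m, varPowIdeal K s 1 ^ m ≤ varPowIdeal K s t := by
    refine Ideal.exists_pow_le_of_le_radical_of_fg (Ideal.span_le.2 ?_) (IsNoetherian.noetherian _)
    rintro _ ⟨i, hi, rfl⟩
    refine ⟨t, ?_⟩
    simp only [pow_one]
    exact Ideal.subset_span (Set.mem_image_of_mem _ hi)
  refine Submodule.smul_mono_left hle (h.ker L _ ?_)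
  have := ext_comp_mk₀_eq_zero (T := ModuleCat.of _ (MvPolynomial σ K ⧸ varPowIdeal K s t)) (t := m)
    (fun a ha y ↦ by
      obtain ⟨y, rfl⟩ := Submodule.mkQ_surjective _ y
      exact (Submodule.Quotient.mk_eq_zero _).2 (Ideal.mul_mem_right y _ (hm ha))) hN hL f
    (h.cls.comp (Ext.mk₀ (elemHom x)) (add_zero _))
  rwa [Ext.comp_assoc_of_third_deg_zero, Ext.mk₀_comp_mk₀, elemHom_comp] at this

end MvPolynomial

end

section

open Limits Abelian

section Basic

variable {R : Type u} [CommRing R] {I : Ideal R} {N L : Type u} [AddCommGroup N] [Module R N]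
  [AddCommGroup L] [Module R L]

lemma LocalExtVanish.of_subsingleton [Subsingleton N] (k : ℕ) : LocalExtVanish I k N :=
  .of_eq_zero fun t e ↦ by
    have : 𝟙 (ModuleCat.of R N) = 0 :=
      (ModuleCat.isZero_of_subsingleton (ModuleCat.of R N)).eq_of_src _ _
    rw [← Ext.comp_mk₀_id e, this, Ext.mk₀_zero, Ext.comp_zero]

lemma LocalExtVanish.zero_of_injective {f : N →ₗ[R] L} (hf : Function.Injective f)
    (h : LocalExtVanish I 0 L) : LocalExtVanish I 0 N := by
  rw [localExtVanish_zero_iff] at h ⊢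
  refine eq_bot_iff.2 ?_
  rintro x ⟨s, hs⟩
  have : f x ∈ powTorsion I L := ⟨s, fun a ha ↦ by rw [← map_smul, hs a ha, map_zero]⟩
  rw [h, Submodule.mem_bot] at this
  exact (Submodule.mem_bot R).2 (hf (this.trans (map_zero f).symm))

/-- Vanishing for the left term of a short exact sequence, including degree `0`. -/
lemma LocalExtVanish.left_of_forall {A B C : Type u} [AddCommGroup A] [AddCommGroup B]
    [AddCommGroup C] [Module R A] [Module R B] [Module R C] {f : A →ₗ[R] B} {g : B →ₗ[R] C}
    (hf : Function.Injective f) (hg : Function.Surjective g) (hfg : Function.Exact f g) {k : ℕ}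
    (hC : ∀ j < k, LocalExtVanish I j C) (hB : LocalExtVanish I k B) :
    LocalExtVanish I k A := by
  cases k with
  | zero => exact zero_of_injective hf hB
  | succ k => exact left hf hg hfg (hC k k.lt_succ_self) hB

end Basic

/-! ### Grade and the first nonvanishing local cohomology -/

section Grade

open RingTheory.Sequence BigradedCM

variable {R : Type u} [CommRing R] {I : Ideal R} {N : Type u} [AddCommGroup N] [Module R N]

lemma isWeaklyRegular_of_subsingleton {M : Type u} [AddCommGroup M] [Module R M] [Subsingleton M]
    (rs : List R) : IsWeaklyRegular M rs := by
  induction rs generalizing M with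
  | nil => simp
  | cons r rs ih =>
    rw [isWeaklyRegular_cons_iff]
    exact ⟨fun x y _ ↦ Subsingleton.elim x y, ih⟩

/-- This serves the case IN = N, where Nakayama supplies such an r: N/rN = 0, so the grade is
infinite. -/
lemma exists_isWeaklyRegular_of_smul_eq_self {r : R} (hr : r ∈ I) (h : ∀ x : N, r • x = x)
    (n : ℕ) : ∃ rs : List R, rs.length = n ∧ (∀ r ∈ rs, r ∈ I) ∧ IsWeaklyRegular N rs := by
  refine ⟨List.replicate n r, by simp, fun a ha ↦ (List.eq_of_mem_replicate ha).symm ▸ hr, ?_⟩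
  cases n with
  | zero => simp
  | succ n =>
    rw [List.replicate_succ, isWeaklyRegular_cons_iff]
    refine ⟨fun x y hxy ↦ by simpa [h] using hxy, ?_⟩
    have : Subsingleton (QuotSMulTop r N) := by
      refine subsingleton_of_forall_eq 0 fun y ↦ ?_
      obtain ⟨x, rfl⟩ := Submodule.mkQ_surjective _ y
      refine (Submodule.Quotient.mk_eq_zero _).2 ?_
      rw [← h x]
      exact Submodule.smul_mem_pointwise_smul x r ⊤ trivial
    exact isWeaklyRegular_of_subsingleton _

/-- On Ext, r acts as 0 through `X` and as 1 through `Y`. -/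
lemma ext_eq_zero_of_smul_eq_self {X Y : ModuleCat.{u} R} {r : R} (hX : ∀ x : X, r • x = 0)
    (hY : ∀ y : Y, r • y = y) {k : ℕ} (e : Ext X Y k) : e = 0 := by
  have h1 : r • 𝟙 X = 0 := by ext x; exact hX x
  have h2 : r • 𝟙 Y = 𝟙 Y := by ext y; exact hY y
  have h3 : r • e = 0 := by
    rw [← Ext.mk₀_id_comp e, ← Ext.smul_comp, ← Ext.mk₀_smul, h1, Ext.mk₀_zero, Ext.zero_comp]
  rw [← h3]
  conv_lhs => rw [← Ext.comp_mk₀_id e, ← h2, Ext.mk₀_smul, Ext.comp_smul, Ext.comp_mk₀_id]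

lemma exists_smul_eq_self_of_smul_top_eq [Module.Finite R N] (h : I • (⊤ : Submodule R N) = ⊤) :
    ∃ r ∈ I, ∀ x : N, r • x = x := by
  obtain ⟨r, hr, h⟩ := Submodule.exists_mem_and_smul_eq_self_of_fg_of_le_smul I
    (⊤ : Submodule R N) Module.Finite.fg_top h.ge
  exact ⟨r, hr, fun x ↦ h x trivial⟩

lemma support_quotient_pow (t : ℕ) :
    Module.support R (R ⧸ I ^ t) ⊆ PrimeSpectrum.zeroLocus I := by
  rw [Module.support_eq_zeroLocus, Ideal.annihilator_quotient]
  exact fun p hp ↦ p.2.le_of_pow_le hp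

theorem localExtVanish_of_isWeaklyRegular [IsNoetherianRing R] [Module.Finite R N] {rs : List R}
    (hI : ∀ r ∈ rs, r ∈ I) (hrs : IsWeaklyRegular N rs) {k : ℕ} (hk : k < rs.length) :
    LocalExtVanish I k N := by
  refine .of_eq_zero fun t e ↦ ?_
  by_cases h : I • (⊤ : Submodule R N) = ⊤
  · obtain ⟨r, hr, hr'⟩ := exists_smul_eq_self_of_smul_top_eq h
    refine ext_eq_zero_of_smul_eq_self (r := r ^ t)
      (pow_smul_quotient t _ (Ideal.pow_mem_pow hr t)) (fun y ↦ ?_) e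
    clear e
    induction t with
    | zero => rw [pow_zero, one_smul]
    | succ t ih => rw [pow_succ, mul_smul, show r • y = y from hr' y, ih]
  · have hreg : IsRegular (ModuleCat.of R N) rs := ⟨hrs, fun htop ↦ h (top_le_iff.1
      (htop.le.trans (Submodule.smul_mono_left (Ideal.span_le.2 hI))))⟩
    exact (ModuleCat.subsingleton_ext_of_exists_isRegular I (ModuleCat.of R (R ⧸ I ^ t))
      (support_quotient_pow t) (ModuleCat.of R N) (lt_top_iff_ne_top.2 h) rs hI hreg k hk).elim e 0

/-- When IN ≠ N this is Rees' characterization of grade by Ext(R/I, N), which vanishes by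
`ext_eq_zero_of_localExtVanish`. -/
theorem exists_isWeaklyRegular_of_localExtVanish [IsNoetherianRing R] [Module.Finite R N] {n : ℕ}
    (h : ∀ k < n, LocalExtVanish I k N) :
    ∃ rs : List R, rs.length = n ∧ (∀ r ∈ rs, r ∈ I) ∧ IsWeaklyRegular N rs := by
  by_cases hI : I • (⊤ : Submodule R N) = ⊤
  · obtain ⟨r, hr, hr'⟩ := exists_smul_eq_self_of_smul_top_eq hI
    exact exists_isWeaklyRegular_of_smul_eq_self hr hr' n
  · obtain ⟨rs, h1, h2, h3⟩ := ModuleCat.exists_isRegular_of_exists_subsingleton_ext I n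
      (ModuleCat.of R N) (lt_top_iff_ne_top.2 hI) (ModuleCat.of R (R ⧸ I))
      (by rw [Module.support_eq_zeroLocus, Ideal.annihilator_quotient]) fun i hi ↦ by
        refine subsingleton_of_forall_eq 0 fun e ↦ ext_eq_zero_of_localExtVanish (t := 1) ?_
          (fun j hj ↦ h j (hj.trans_lt hi)) e
        intro a ha x
        obtain ⟨y, rfl⟩ := Submodule.mkQ_surjective _ x
        exact (Submodule.Quotient.mk_eq_zero I).2 (I.mul_mem_right y (by simpa using ha))
    exact ⟨rs, h1, h2, h3.toIsWeaklyRegular⟩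

theorem localExtVanish_of_lt_grade [IsNoetherianRing R] [Module.Finite R N] {k : ℕ}
    (h : (k : ℕ∞) < BigradedCM.grade I N) : LocalExtVanish I k N := by
  obtain ⟨_, ⟨rs, hI, hrs, rfl⟩, hk⟩ := lt_sSup_iff.1 h
  exact localExtVanish_of_isWeaklyRegular hI hrs (by exact_mod_cast hk)

theorem grade_eq_natCast [IsNoetherianRing R] [Module.Finite R N] {q : ℕ}
    (h : ∀ k < q, LocalExtVanish I k N) (hq : ¬ LocalExtVanish I q N) : BigradedCM.grade I N = q := by
  refine le_antisymm (not_lt.1 fun hlt ↦ hq (localExtVanish_of_lt_grade hlt)) ?_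
  obtain ⟨rs, h1, h2, h3⟩ := exists_isWeaklyRegular_of_localExtVanish h
  unfold BigradedCM.grade
  exact le_sSup ⟨rs, h2, h3, by rw [h1]⟩

end Grade

/-! ### Cohomological dimension -/

section CohomologicalDimension

open BigradedCM

variable {R : Type u} [CommRing R] {I : Ideal R} {N : Type u} [AddCommGroup N] [Module R N]

lemma isZero_H_iff {k : ℕ} : IsZero (H I k N) ↔ LocalExtVanish I k N :=
  isZero_localCohomology_iff I k N

lemma localExtVanish_of_cd_lt {k : ℕ} (h : cd I N < ((k : ℕ∞) : WithBot ℕ∞)) :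
    LocalExtVanish I k N := by
  by_contra hk
  refine (not_le.2 h) ?_
  unfold cd
  exact le_sSup ⟨k, fun hz ↦ hk (isZero_H_iff.1 hz), rfl⟩

/-- The strict inequality lets d = 0 express that the cohomological dimension is -∞. -/
lemma cd_lt_natCast {d : ℕ} (h : ∀ k, d ≤ k → LocalExtVanish I k N) :
    cd I N < ((d : ℕ∞) : WithBot ℕ∞) := by
  have hlt {i : ℕ} (hi : ¬ IsZero (H I i N)) : i < d := by
    by_contra hd
    exact hi (isZero_H_iff.2 (h i (not_lt.1 hd)))
  cases d with
  | zero =>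
    refine lt_of_le_of_lt (b := ⊥) (sSup_le ?_) (WithBot.bot_lt_coe _)
    rintro _ ⟨i, hi, rfl⟩
    exact absurd (hlt hi) (Nat.not_lt_zero i)
  | succ d =>
    refine lt_of_le_of_lt (b := ((d : ℕ∞) : WithBot ℕ∞)) (sSup_le ?_)
      (WithBot.coe_lt_coe.2 (Nat.cast_lt.2 d.lt_succ_self))
    rintro _ ⟨i, hi, rfl⟩
    exact WithBot.coe_le_coe.2 (Nat.cast_le.2 (Nat.lt_succ_iff.1 (hlt hi)))

lemma cd_eq_natCast {q : ℕ} (h : ∀ k, q < k → LocalExtVanish I k N)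
    (hq : ¬ LocalExtVanish I q N) : cd I N = ((q : ℕ∞) : WithBot ℕ∞) := by
  refine le_antisymm (sSup_le ?_) (le_sSup ⟨q, fun hz ↦ hq (isZero_H_iff.1 hz), rfl⟩)
  rintro _ ⟨i, hi, rfl⟩
  refine WithBot.coe_le_coe.2 (Nat.cast_le.2 (not_lt.1 fun hlt ↦ hi (isZero_H_iff.2 (h i hlt))))

lemma not_localExtVanish_of_cd_eq {q : ℕ} (h : cd I N = ((q : ℕ∞) : WithBot ℕ∞)) :
    ¬ LocalExtVanish I q N := by
  refine fun hq ↦ (cd_lt_natCast fun k hk ↦ ?_).ne h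
  obtain rfl | hk := hk.eq_or_lt
  · exact hq
  · exact localExtVanish_of_cd_lt (h ▸ WithBot.coe_lt_coe.2 (Nat.cast_lt.2 hk))

end CohomologicalDimension

/-! ### Using the grading by y-degree -/

section Graded

open BigradedCM MvPolynomial

variable {K : Type u} [Field K] {m n : ℕ}

lemma Q_eq_varPowIdeal :
    Q K m n = varPowIdeal K (Finset.univ.map (Function.Embedding.inr : Fin n ↪ Fin m ⊕ Fin n)) 1 := by
  simp only [Q, varPowIdeal, pow_one, Finset.coe_map, Finset.coe_univ, Set.image_univ]
  rw [← Set.range_comp]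
  rfl

variable {M : Type u} [AddCommGroup M] [Module (S K m n) M] (ℳ : ℤ × ℤ → AddSubgroup M)
  [DirectSum.Decomposition ℳ] [SetLike.GradedSMul (bigrading K m n) ℳ]

open DirectSum

lemma decompose_smul_of_mem {s : S K m n} {e : ℤ × ℤ} (hs : s ∈ bigrading K m n e) (x : M)
    (d : ℤ × ℤ) : (decompose ℳ (s • x) d : M) = s • (decompose ℳ x (d - e) : M) := by
  induction x using DirectSum.Decomposition.inductionOn ℳ with
  | zero => simp
  | @homogeneous j y =>
    have hy : s • (y : M) ∈ ℳ (e + j) := SetLike.GradedSMul.smul_mem hs y.2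
    by_cases h : j = d - e
    · subst h
      rw [add_sub_cancel] at hy
      rw [decompose_of_mem_same ℳ hy, decompose_of_mem_same ℳ y.2]
    · rw [decompose_of_mem_ne ℳ hy (by rintro rfl; simp at h), decompose_of_mem_ne ℳ y.2 h,
        smul_zero]
  | add x y hx hy => simp only [smul_add, decompose_add, DirectSum.add_apply, AddSubgroup.coe_add, hx, hy]

/-- The elements whose components of `y`-degree at most `k` lie in `F`. -/
def lowDegreeMem (F : Submodule (S K m n) M) (k : ℤ) : AddSubgroup M where
  carrier := {x | ∀ d : ℤ × ℤ, d.2 ≤ k → (decompose ℳ x d : M) ∈ F}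
  zero_mem' := by simp
  add_mem' := fun hx hy d hd ↦ by
    rw [decompose_add, DirectSum.add_apply, AddSubgroup.coe_add]
    exact add_mem (hx d hd) (hy d hd)
  neg_mem' := fun hx d hd ↦ by
    rw [decompose_neg]
    exact neg_mem (hx d hd)

lemma smul_mem_lowDegreeMem {F : Submodule (S K m n) M} {k : ℤ} {r : S K m n} (hr : r ∈ Q K m n)
    {x : M} (hx : x ∈ lowDegreeMem ℳ F k) : r • x ∈ lowDegreeMem ℳ F (k + 1) := by
  rw [Q_eq_varPowIdeal, mem_varPowIdeal] at hr
  rw [r.as_sum, Finset.sum_smul]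
  refine sum_mem fun v hv d hd ↦ ?_
  rw [decompose_smul_of_mem ℳ (isWeightedHomogeneous_monomial (varDeg m n) v _ rfl)]
  refine F.smul_mem _ (hx _ ?_)
  obtain ⟨i, hi, hvi⟩ := hr v hv
  obtain ⟨j, -, rfl⟩ := Finset.mem_map.1 hi
  have : 1 ≤ (Finsupp.weight (varDeg m n) v).2 := by
    rw [Finsupp.weight_apply, Finsupp.sum_fintype _ _ (by simp), Prod.snd_sum, Fintype.sum_sum_type]
    simp only [varDeg, Sum.elim_inl, Sum.elim_inr, Prod.smul_mk, smul_zero, Finset.sum_const_zero,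
      zero_add, nsmul_eq_mul, mul_one]
    have h1 := Finset.single_le_sum (f := fun j : Fin n ↦ ((v (Sum.inr j) : ℕ) : ℤ))
      (fun _ _ ↦ by positivity) (Finset.mem_univ j)
    refine le_trans ?_ h1
    exact_mod_cast hvi
  simp only [Prod.snd_sub]
  omega

/-- A graded Nakayama argument: every monomial of r contains some y_j, so multiplication by r raises
y-degree. Writing x = (x - rx) + rx, membership in `F` of the components of y-degree ≤ k extends to
k + 1; it holds for small k since x has finitely many components. -/
lemma mem_of_sub_smul_mem {F : Submodule (S K m n) M} (hF : F.IsHomogeneous ℳ) {r : S K m n}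
    (hr : r ∈ Q K m n) {x : M} (hx : x - r • x ∈ F) : x ∈ F := by
  classical
  have step (k : ℤ) (hk : x ∈ lowDegreeMem ℳ F k) : x ∈ lowDegreeMem ℳ F (k + 1) := by
    have h1 : x - r • x ∈ lowDegreeMem ℳ F (k + 1) := fun d _ ↦ hF d hx
    simpa using add_mem h1 (smul_mem_lowDegreeMem ℳ hr hk)
  have start : ∃ k : ℤ, x ∈ lowDegreeMem ℳ F k := by
    obtain ⟨b, hb⟩ := ((decompose ℳ x).support.image Prod.snd).bddBelow
    refine ⟨b - 1, fun d hd ↦ ?_⟩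
    have : d ∉ (decompose ℳ x).support := fun h ↦ by
      have := hb (Finset.mem_coe.2 (Finset.mem_image_of_mem Prod.snd h))
      omega
    rw [DFinsupp.notMem_support_iff.1 this]
    exact zero_mem F
  obtain ⟨k, hk⟩ := start
  have all (j : ℕ) : x ∈ lowDegreeMem ℳ F (k + j) := by
    induction j with
    | zero => simpa using hk
    | succ j ih =>
      have := step _ ih
      push_cast
      rwa [← add_assoc]
  rw [Submodule.IsHomogeneous.mem_iff ℳ hF]
  intro d
  exact all (d.2 - k).toNat d (by omega)

/-- A submodule with local cohomology only in degrees `< d` is contained in a bigraded submodule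
`F` such that the local cohomology of `M ⧸ F` lives in degrees `≥ d`. -/
theorem le_of_localExtVanish [Module.Finite (S K m n) M] {F N : Submodule (S K m n) M}
    (hF : F.IsHomogeneous ℳ) {d : ℕ} (hN : ∀ k, d ≤ k → LocalExtVanish (Q K m n) k N)
    (hL : ∀ k < d, LocalExtVanish (Q K m n) k (M ⧸ F)) : N ≤ F := by
  intro x hx
  have hmem : F.mkQ x ∈ (⨅ t : ℕ, Q K m n ^ t • ⊤ : Submodule (S K m n) (M ⧸ F)) := by
    refine (Submodule.mem_iInf _).2 fun t ↦ ?_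
    rw [Q_eq_varPowIdeal] at hN hL ⊢
    exact apply_mem_pow_smul_top _ hN hL (F.mkQ ∘ₗ N.subtype) t ⟨x, hx⟩
  -- Krull: an element of every Q^t L is fixed by some r ∈ Q.
  obtain ⟨⟨r, hr⟩, h⟩ := ((Q K m n).mem_iInf_smul_pow_eq_bot_iff _).1 hmem
  refine mem_of_sub_smul_mem ℳ hF hr ((Submodule.Quotient.eq F).1 ?_)
  exact h.symm

end Graded

end

section

open Limits BigradedCM

section SubmoduleSequences

variable {R : Type u} [CommRing R] {M : Type u} [AddCommGroup M] [Module R M]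
  {A B : Submodule R M}

lemma exact_inclusion_mkQ (h : A ≤ B) :
    Function.Exact (Submodule.inclusion h) (A.submoduleOf B).mkQ := by
  intro x
  rw [Submodule.mkQ_apply, Submodule.Quotient.mk_eq_zero]
  exact ⟨fun hx ↦ ⟨⟨x, hx⟩, rfl⟩, fun ⟨y, hy⟩ ↦ hy ▸ y.2⟩

lemma injective_mapQ_subtype :
    Function.Injective ((A.submoduleOf B).mapQ A B.subtype le_rfl) := by
  refine (injective_iff_map_eq_zero _).2 fun y hy ↦ ?_
  obtain ⟨x, rfl⟩ := Submodule.mkQ_surjective _ y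
  exact (Submodule.Quotient.mk_eq_zero _).2 ((Submodule.Quotient.mk_eq_zero A).1 hy)

lemma exact_mapQ_factor (h : A ≤ B) :
    Function.Exact ((A.submoduleOf B).mapQ A B.subtype le_rfl) (Submodule.factor h) := by
  intro y
  obtain ⟨x, rfl⟩ := Submodule.mkQ_surjective _ y
  constructor
  · intro hx
    have hx : x ∈ B := (Submodule.Quotient.mk_eq_zero B).1 hx
    exact ⟨Submodule.Quotient.mk ⟨x, hx⟩, rfl⟩
  · rintro ⟨z, hz⟩
    obtain ⟨w, rfl⟩ := Submodule.mkQ_surjective _ z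
    rw [← hz]
    exact (Submodule.Quotient.mk_eq_zero B).2 w.2

end SubmoduleSequences

/-! ### Cohen–Macaulay and dimension filtrations -/

section Filtration

variable {K : Type u} [Field K] {m n : ℕ} {M : Type u} [AddCommGroup M] [Module (S K m n) M]
  {ℳ : ℤ × ℤ → AddSubgroup M} [DirectSum.Decomposition ℳ] {s : ℕ}
  {F : Fin (s + 1) → Submodule (S K m n) M} {q : Fin s → ℕ}

lemma BigradedCM.IsCohenMacaulay.exists_cd_eq {R : Type u} [CommRing R] {I : Ideal R} {N : Type u}
    [AddCommGroup N] [Module R N] (h : IsCohenMacaulay I N) (h0 : 0 ≤ cd I N) :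
    ∃ q : ℕ, cd I N = ((q : ℕ∞) : WithBot ℕ∞) ∧ (∀ k, k ≠ q → LocalExtVanish I k N) ∧
      ¬ LocalExtVanish I q N := by
  obtain ⟨q, hq⟩ := h
  have hv : ∀ k, k ≠ q → LocalExtVanish I k N := fun k hk ↦ isZero_H_iff.1 (hq k hk)
  have hnq : ¬ LocalExtVanish I q N := fun hq' ↦ by
    have : cd I N < ((0 : ℕ) : ℕ∞) := cd_lt_natCast fun k _ ↦ by
      by_cases hk : k = q
      · exact hk ▸ hq'
      · exact hv k hk
    exact absurd h0 (not_le.2 this)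
  exact ⟨q, cd_eq_natCast (fun k hk ↦ hv k hk.ne') hnq, hv, hnq⟩

lemma localExtVanish_filtration (hF : IsBigradedFiltration ℳ F)
    (hq : ∀ i k, k ≠ q i → LocalExtVanish (Q K m n) k (succQuot F i)) (j : Fin (s + 1)) (k : ℕ)
    (hk : ∀ i : Fin s, i.castSucc < j → q i < k) : LocalExtVanish (Q K m n) k (F j) := by
  induction j using Fin.induction with
  | zero =>
    rw [hF.bot]
    exact .of_subsingleton k
  | succ i ih =>
    have h := (hF.lt i).le
    exact .middle (Submodule.inclusion_injective h) (Submodule.mkQ_surjective _)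
      (exact_inclusion_mkQ h) (ih fun i' hi' ↦ hk i' (hi'.trans i.castSucc_lt_succ))
      (hq i k (hk i i.castSucc_lt_succ).ne')

lemma localExtVanish_quotient_filtration (hF : IsBigradedFiltration ℳ F)
    (hq : ∀ i k, k ≠ q i → LocalExtVanish (Q K m n) k (succQuot F i)) (j : Fin (s + 1)) (k : ℕ)
    (hk : ∀ i : Fin s, j ≤ i.castSucc → k < q i) : LocalExtVanish (Q K m n) k (M ⧸ F j) := by
  induction j using Fin.reverseInduction with
  | last =>
    rw [hF.top]
    exact .of_subsingleton k
  | cast i ih =>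
    have h := (hF.lt i).le
    exact .middle injective_mapQ_subtype (Submodule.factor_surjective h)
      (exact_mapQ_factor h) (hq i k (hk i le_rfl).ne)
      (ih fun i' hi' ↦ hk i' (i.castSucc_lt_succ.le.trans hi'))

/-- A Cohen–Macaulay filtration is a dimension filtration, and the local cohomology of `M ⧸ F_{i-1}`
vanishes below `cd(F_i)`. -/
lemma BigradedCM.IsCohenMacaulayFiltration.isDimensionFiltration [Module.Finite (S K m n) M]
    [SetLike.GradedSMul (bigrading K m n) ℳ] (hF : IsCohenMacaulayFiltration ℳ F) :
    IsDimensionFiltration ℳ F ∧ ∀ (i : Fin s) (k : ℕ),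
      ((k : ℕ∞) : WithBot ℕ∞) < cd (Q K m n) (F i.succ) →
        LocalExtVanish (Q K m n) k (M ⧸ F i.castSucc) := by
  choose q hcd hv hnv using fun i ↦
    IsCohenMacaulay.exists_cd_eq (hF.cohenMacaulay i) (hF.cd_nonneg i)
  have hmono : StrictMono q := fun i j hij ↦ by
    have := hF.cd_strictMono hij
    simp only [hcd] at this
    exact_mod_cast this
  have hsub (i : Fin s) (k : ℕ) (hk : q i ≤ k) : LocalExtVanish (Q K m n) k (F i.castSucc) :=
    localExtVanish_filtration hF.toIsBigradedFiltration hv _ k fun i' hi' ↦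
      (hmono (Fin.castSucc_lt_castSucc_iff.1 hi')).trans_le hk
  have hquot (i : Fin s) (k : ℕ) (hk : k < q i) :
      LocalExtVanish (Q K m n) k (M ⧸ F i.castSucc) :=
    localExtVanish_quotient_filtration hF.toIsBigradedFiltration hv _ k fun i' hi' ↦
      hk.trans_le (hmono.monotone (Fin.castSucc_le_castSucc_iff.1 hi'))
  have hcdF (i : Fin s) : cd (Q K m n) (F i.succ) = ((q i : ℕ∞) : WithBot ℕ∞) := by
    have h := (hF.lt i).le
    refine cd_eq_natCast (fun k hk ↦ ?_) fun hq ↦ hnv i ?_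
    · exact localExtVanish_filtration hF.toIsBigradedFiltration hv _ k fun i' hi' ↦
        (hmono.monotone (Fin.castSucc_lt_succ_iff.1 hi')).trans_lt hk
    -- If F_i had no local cohomology in degree q_i, neither would F_i/F_{i-1}, as F_{i-1} has none
    -- in degree q_i + 1.
    · exact .right (Submodule.inclusion_injective h) (Submodule.mkQ_surjective _)
        (exact_inclusion_mkQ h) hq (hsub i _ (Nat.le_succ _))
  refine ⟨⟨hF.toIsBigradedFiltration, fun i ↦ ⟨⟨hF.homogeneous _, (hF.lt i).le, ?_⟩, ?_⟩⟩, ?_⟩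
  · rw [hcdF]
    exact cd_lt_natCast (hsub i)
  · rintro N ⟨-, -, hN⟩
    rw [hcdF] at hN
    exact le_of_localExtVanish ℳ (hF.homogeneous _) (fun k hk ↦ localExtVanish_of_cd_lt
      (hN.trans_le (WithBot.coe_le_coe.2 (Nat.cast_le.2 hk)))) (hquot i)
  · intro i k hk
    rw [hcdF] at hk
    exact hquot i k (by exact_mod_cast hk)

/-- Dimension filtrations are unique. -/
lemma BigradedCM.IsDimensionFiltration.exists_eq {r : ℕ} {D : Fin (r + 1) → Submodule (S K m n) M}
    (hD : IsDimensionFiltration ℳ D) (hF : IsDimensionFiltration ℳ F) (i : Fin r) :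
    ∃ j : Fin s, D i.succ = F j.succ ∧ D i.castSucc = F j.castSucc := by
  suffices ∃ j : Fin s, D i.succ = F j.succ by
    obtain ⟨j, hj⟩ := this
    refine ⟨j, hj, (hD.isGreatest i).unique ?_⟩
    rw [hj]
    exact hF.isGreatest j
  -- Downward induction: both filtrations end at M, and each term determines the one below it as a
  -- greatest element.
  have key (k : Fin (r + 1)) : ∀ i : Fin r, i.succ = k → ∃ j : Fin s, D i.succ = F j.succ := by
    induction k using Fin.reverseInduction with
    | last =>
      intro i hi
      obtain _ | s := s
      · have h1 : (⊤ : Submodule (S K m n) M) = ⊥ := hF.top.symm.trans hF.bot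
        have h2 := hD.lt i
        rw [hi, hD.top, h1] at h2
        exact absurd h2 not_lt_bot
      · exact ⟨Fin.last s, by rw [hi, hD.top, Fin.succ_last, hF.top]⟩
    | cast k ih =>
      intro i hi
      obtain ⟨j, hj⟩ := ih k rfl
      have hcast : D k.castSucc = F j.castSucc := by
        refine (hD.isGreatest k).unique ?_
        rw [hj]
        exact hF.isGreatest j
      rw [hi, hcast]
      obtain hj0 | ⟨j', hj'⟩ := Fin.eq_zero_or_eq_succ j.castSucc
      · have h2 := hD.lt i
        rw [hi, hcast, hj0, hF.bot] at h2
        exact absurd h2 not_lt_bot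
      · exact ⟨j', by rw [hj']⟩
  exact key _ i rfl

lemma BigradedCM.IsDimensionFiltration.cd_strictMono (hF : IsDimensionFiltration ℳ F) :
    StrictMono fun i : Fin s ↦ cd (Q K m n) (F i.succ) := by
  obtain _ | s := s
  · exact fun i ↦ i.elim0
  · refine Fin.strictMono_iff_lt_succ.2 fun i ↦ ?_
    exact (hF.isGreatest i.succ).1.2.2

/-- If the local cohomology of `M ⧸ D_{i-1}` vanishes below `cd(D_i)` for all `i`, then `D_i/D_{i-1}`
is Cohen–Macaulay of the same cohomological dimension as `D_i`. -/
lemma BigradedCM.IsDimensionFiltration.exists_cd_eq (hF : IsDimensionFiltration ℳ F)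
    (h : ∀ (i : Fin s) (k : ℕ), ((k : ℕ∞) : WithBot ℕ∞) < cd (Q K m n) (F i.succ) →
      LocalExtVanish (Q K m n) k (M ⧸ F i.castSucc)) (i : Fin s) :
    ∃ q : ℕ, cd (Q K m n) (F i.succ) = ((q : ℕ∞) : WithBot ℕ∞) ∧
      (∀ k, k ≠ q → LocalExtVanish (Q K m n) k (succQuot F i)) ∧
      ¬ LocalExtVanish (Q K m n) q (succQuot F i) ∧
      ¬ LocalExtVanish (Q K m n) q (M ⧸ F i.castSucc) := by
  have hle := (hF.lt i).le
  have hlt : cd (Q K m n) (F i.castSucc) < cd (Q K m n) (F i.succ) := (hF.isGreatest i).1.2.2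
  have hcast {a b : ℕ} (hab : a < b) : ((a : ℕ∞) : WithBot ℕ∞) < ((b : ℕ∞) : WithBot ℕ∞) :=
    WithBot.coe_lt_coe.2 (Nat.cast_lt.2 hab)
  -- Below the last index the hypothesis for i + 1 applies because cd increases; at the last one the
  -- quotient is zero.
  have hnext (k : ℕ) (hk : ((k : ℕ∞) : WithBot ℕ∞) < cd (Q K m n) (F i.succ)) :
      LocalExtVanish (Q K m n) k (M ⧸ F i.succ) := by
    obtain ⟨j, hj⟩ | hi := Fin.eq_castSucc_or_eq_last i.succ
    · rw [hj] at hk ⊢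
      exact h j k (hk.trans (hF.isGreatest j).1.2.2)
    · rw [hi, hF.top]
      exact .of_subsingleton k
  have hleft (k : ℕ) (hk : ∀ j < k, ((j : ℕ∞) : WithBot ℕ∞) < cd (Q K m n) (F i.succ))
      (hM : LocalExtVanish (Q K m n) k (M ⧸ F i.castSucc)) :
      LocalExtVanish (Q K m n) k (succQuot F i) :=
    .left_of_forall injective_mapQ_subtype (Submodule.factor_surjective hle)
      (exact_mapQ_factor hle) (fun j hj ↦ hnext j (hk j hj)) hM
  have hbelow (k : ℕ) (hk : ((k : ℕ∞) : WithBot ℕ∞) < cd (Q K m n) (F i.succ)) :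
      LocalExtVanish (Q K m n) k (succQuot F i) :=
    hleft k (fun j hj ↦ (hcast hj).trans hk) (h i k hk)
  have hmid (k : ℕ) : LocalExtVanish (Q K m n) k (F i.castSucc) →
      LocalExtVanish (Q K m n) k (succQuot F i) → LocalExtVanish (Q K m n) k (F i.succ) :=
    .middle (Submodule.inclusion_injective hle) (Submodule.mkQ_surjective _)
      (exact_inclusion_mkQ hle)
  obtain ⟨q, hq⟩ : ∃ q : ℕ, cd (Q K m n) (F i.succ) = ((q : ℕ∞) : WithBot ℕ∞) := by
    -- Were cd infinite, D_i/D_{i-1} would have no local cohomology, and cd(D_i) would be bounded by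
    -- the finite b chosen above cd(D_{i-1}).
    have htop : cd (Q K m n) (F i.succ) ≠ ⊤ := fun htop ↦ by
      have hall (k : ℕ) : ((k : ℕ∞) : WithBot ℕ∞) < ⊤ :=
        WithBot.coe_lt_coe.2 (ENat.natCast_lt_top k)
      obtain ⟨b, hb⟩ : ∃ b : ℕ, cd (Q K m n) (F i.castSucc) < ((b : ℕ∞) : WithBot ℕ∞) := by
        rw [htop] at hlt
        generalize cd (Q K m n) (F i.castSucc) = c at hlt
        induction c with
        | bot => exact ⟨0, WithBot.bot_lt_coe _⟩
        | coe c =>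
          obtain ⟨c, rfl⟩ := ENat.ne_top_iff_exists.1 (WithBot.coe_lt_coe.1 hlt).ne
          exact ⟨c + 1, hcast c.lt_succ_self⟩
      have := cd_lt_natCast (I := Q K m n) (N := F i.succ) (d := b) fun k hk ↦ hmid k
        (localExtVanish_of_cd_lt (hb.trans_le (WithBot.coe_le_coe.2 (Nat.cast_le.2 hk))))
        (hbelow k (htop ▸ hall k))
      rw [htop] at this
      exact absurd this not_top_lt
    generalize cd (Q K m n) (F i.succ) = c at hlt htop
    induction c with
    | bot => exact absurd hlt not_lt_bot
    | coe c =>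
      obtain ⟨c, rfl⟩ := ENat.ne_top_iff_exists.1 (fun hc : c = ⊤ ↦ htop (by rw [hc]; rfl))
      exact ⟨c, rfl⟩
  have hnq : ¬ LocalExtVanish (Q K m n) q (succQuot F i) := fun hv ↦
    not_localExtVanish_of_cd_eq hq (hmid q (localExtVanish_of_cd_lt (hq ▸ hlt)) hv)
  refine ⟨q, hq, fun k hk ↦ ?_, hnq, fun hv ↦ hnq (hleft q (fun j hj ↦ hq ▸ hcast hj) hv)⟩
  obtain hk | hk := hk.lt_or_gt
  · exact hbelow k (hq ▸ hcast hk)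
  · have hqk : cd (Q K m n) (F i.succ) < ((k : ℕ∞) : WithBot ℕ∞) := hq ▸ hcast hk
    exact .right (Submodule.inclusion_injective hle) (Submodule.mkQ_surjective _)
      (exact_inclusion_mkQ hle) (localExtVanish_of_cd_lt hqk)
      (localExtVanish_of_cd_lt ((hlt.trans hqk).trans (hcast k.lt_succ_self)))

end Filtration

end

end

/-! ### The equivalence -/

theorem proposition2p2 {K : Type u} [Field K] {m n : ℕ}
    {M : Type u} [AddCommGroup M] [Module (BigradedCM.S K m n) M]
    [Module.Finite (BigradedCM.S K m n) M]
    (ℳ : ℤ × ℤ → AddSubgroup M) [DirectSum.Decomposition ℳ]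
    [SetLike.GradedSMul (BigradedCM.bigrading K m n) ℳ]
    {r : ℕ} (D : Fin (r + 1) → Submodule (BigradedCM.S K m n) M)
    (hD : BigradedCM.IsDimensionFiltration ℳ D) :
    List.TFAE [
      BigradedCM.IsSequentiallyCohenMacaulay K m n ℳ,
      ∀ i : Fin r, ∀ k : ℕ,
        ((k : ℕ∞) : WithBot ℕ∞) < BigradedCM.cd (BigradedCM.Q K m n) (D i.succ) →
          CategoryTheory.Limits.IsZero
            (BigradedCM.H (BigradedCM.Q K m n) k (M ⧸ D i.castSucc)),
      ∀ i : Fin r,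
        ((BigradedCM.grade (BigradedCM.Q K m n) (M ⧸ D i.castSucc) : ℕ∞) : WithBot ℕ∞) =
          BigradedCM.cd (BigradedCM.Q K m n) (D i.succ)] := by
  have hiff : (∀ i : Fin r, ∀ k : ℕ,
        ((k : ℕ∞) : WithBot ℕ∞) < BigradedCM.cd (BigradedCM.Q K m n) (D i.succ) →
          CategoryTheory.Limits.IsZero
            (BigradedCM.H (BigradedCM.Q K m n) k (M ⧸ D i.castSucc))) ↔
      ∀ (i : Fin r) (k : ℕ),
        ((k : ℕ∞) : WithBot ℕ∞) < BigradedCM.cd (BigradedCM.Q K m n) (D i.succ) →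
          LocalExtVanish (BigradedCM.Q K m n) k (M ⧸ D i.castSucc) :=
    forall_congr' fun i ↦ forall_congr' fun k ↦ imp_congr_right fun _ ↦ isZero_H_iff
  tfae_have 1 → 2 := by
    rintro ⟨s, F, hF⟩
    obtain ⟨hF', hv⟩ := BigradedCM.IsCohenMacaulayFiltration.isDimensionFiltration hF
    refine hiff.2 fun i k hk ↦ ?_
    obtain ⟨j, h1, h2⟩ := BigradedCM.IsDimensionFiltration.exists_eq hD hF' i
    rw [h1] at hk
    rw [h2]
    exact hv j k hk
  tfae_have 2 → 1 := fun h ↦ by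
    choose q hcd hv hnv _ using BigradedCM.IsDimensionFiltration.exists_cd_eq hD (hiff.1 h)
    have hcd' (i : Fin r) : BigradedCM.cd (BigradedCM.Q K m n) (BigradedCM.succQuot D i) =
        BigradedCM.cd (BigradedCM.Q K m n) (D i.succ) :=
      (cd_eq_natCast (fun k hk ↦ hv i k hk.ne') (hnv i)).trans (hcd i).symm
    refine ⟨r, D, hD.toIsBigradedFiltration, fun i ↦ ⟨q i, fun k hk ↦ isZero_H_iff.2 (hv i k hk)⟩,
      fun i ↦ ?_, ?_⟩
    · rw [hcd', hcd]
      exact WithBot.coe_le_coe.2 (bot_le)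
    · simp only [hcd']
      exact BigradedCM.IsDimensionFiltration.cd_strictMono hD
  tfae_have 2 → 3 := fun h i ↦ by
    obtain ⟨q, hcd, -, -, hnv⟩ := BigradedCM.IsDimensionFiltration.exists_cd_eq hD (hiff.1 h) i
    rw [hcd, grade_eq_natCast (fun k hk ↦ hiff.1 h i k ?_) hnv]
    rw [hcd]
    exact WithBot.coe_lt_coe.2 (Nat.cast_lt.2 hk)
  tfae_have 3 → 2 := fun h ↦ hiff.2 fun i k hk ↦ by
    rw [← h i] at hk
    exact localExtVanish_of_lt_grade (WithBot.coe_lt_coe.1 hk)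
  tfae_finish
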